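/- Let $X$ be a finite set with at least $3$ elements and let $\mathbb S=\mathbb P^1(\mathbb C)=\mathbb C\cup\{\infty\}$. A (stable) tree of spheres $\mathcal T$ marked by $X$ consists of a finite combinatorial tree $T$ whose leaves (vertices of valence $1$) are the elements of $X$ and all of whose other (internal) vertices have valence at least $3$; for each internal vertex $v$, a topological sphere $\mathcal S_v$ with a projective structure, i.e. a class of homeomorphisms (charts) $\mathcal S_v\to\mathbb S$ that is one full equivalence class for the relation of differing by post-composition with a Moebius transformation; and, for each internal vertex $v$, an injection $i_v:E_v\to\mathcal S_v$ of the set of edges at $v$. For $x\in X$ put $a_v(x)=i_v(e)$, where $e\in E_v$ is the edge lying in the same connected component of $T-\{v\}$ as $x$. Two trees of spheres are isomorphic if there is an isomorphism of combinatorial trees that is the identity on $X$ together with projective isomorphisms of the corresponding spheres compatible with the maps $i_v$. Let $\overline{\mathbf{Mod}}_X$ be the set of isomorphism classes, and let $\mathbf{Mod}_X\subset\overline{\mathbf{Mod}}_X$ be the set of classes of trees of spheres with exactly one internal vertex (marked spheres). For every triple $t=(x_0,x_1,x_\infty)$ of distinct elements of $X$ there is a unique internal vertex $v$ such that $x_0,x_1,x_\infty$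 lie in three different components of $T-\{v\}$; let $\sigma_t$ be the unique chart of $\mathcal S_v$ with $\sigma_t(a_v(x_0))=0$, $\sigma_t(a_v(x_1))=1$, $\sigma_t(a_v(x_\infty))=\infty$, and put $\alpha_t=\sigma_t\circ a_v:X\to\mathbb S$. Let $\mathrm{Quad}_X$ be the set of quadruples $(t,x)=(x_0,x_1,x_\infty,x)$ of distinct elements of $X$. The family $(\alpha_t(x))_{(t,x)\in\mathrm{Quad}_X}$ depends only on the isomorphism class of $\mathcal T$ and defines the cross-ratio map $$\mathfrak B:\overline{\mathbf{Mod}}_X\to\mathbb S^{\mathrm{Quad}_X}.$$ Give $\mathbb S^{\mathrm{Quad}_X}$ the product topology and $\overline{\mathbf{Mod}}_X$ the topology induced by $\mathfrak B$. Theorem. (1) $\mathfrak B$ is a homeomorphism onto its image. (2) $\mathfrak B(\mathbf{Mod}_X)$ is the set of all families $\big([i(x_0),i(x_1),i(x_\infty),i(x)]\big)_{(x_0,x_1,x_\infty,x)\in\mathrm{Quad}_X}$ with $i:X\to\mathbb S$ injective, where $[z_0,z_1,z_\infty,z]$ is the image of $z$ under the Moebius transformation that maps $z_0,z_1,z_\infty$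 to $0,1,\infty$. (3) $\mathfrak B(\overline{\mathbf{Mod}}_X)=\overline{\mathfrak B(\mathbf{Mod}_X)}$, the closure being taken in $\mathbb S^{\mathrm{Quad}_X}$. (4) The space $\overline{\mathbf{Mod}}_X$ is compact, and $\mathbf{Mod}_X$ is dense in it. -/

import Mathlib

open Filter Topology

universe u

namespace TreesOfSpheres

/-! ### The Riemann sphere and projective spheres

The Riemann sphere is `OnePoint ℂ`. Moebius transformations are the maps `z ↦ g • z` for
`g : GL (Fin 2) ℂ`, where `•` is the action of Mathlib on `OnePoint ℂ`. -/

/-- The Riemann sphere `ℙ¹(ℂ) = ℂ ∪ {∞}`. -/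
abbrev Sphere : Type := OnePoint ℂ

/-- Moebius transformations are continuous. -/
theorem continuous_moebius (g : GL (Fin 2) ℂ) : Continuous fun z : Sphere => g • z := by
  have hdet : g 0 0 * g 1 1 - g 0 1 * g 1 0 ≠ 0 := by
    have := g.det_ne_zero
    rwa [Matrix.det_fin_two] at this
  rw [continuous_iff_continuousAt]
  intro z
  induction z using OnePoint.rec with
  | infty =>
    rw [OnePoint.continuousAt_infty', Filter.coclosedCompact_eq_cocompact,
      OnePoint.smul_infty_eq_ite]
    by_cases hc : g 1 0 = 0
    · rw [if_pos hc]
      have hd : g 1 1 ≠ 0 := by rintro h; simp [h, hc] at hdet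
      have ha : g 0 0 ≠ 0 := by rintro h; simp [h, hc] at hdet
      have h1 : Tendsto (fun k : ℂ => g 0 0 / g 1 1 * k + g 0 1 / g 1 1) (cocompact ℂ)
          (cocompact ℂ) :=
        (((Homeomorph.mulLeft₀ (g 0 0 / g 1 1) (div_ne_zero ha hd)).trans
          (Homeomorph.addRight (g 0 1 / g 1 1))).isClosedEmbedding.tendsto_cocompact)
      have h2 := (OnePoint.tendsto_coe_infty (X := ℂ))
      rw [Filter.coclosedCompact_eq_cocompact] at h2
      refine (h2.comp h1).congr fun k => ?_
      simp only [Function.comp_apply]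
      rw [OnePoint.smul_some_eq_ite, if_neg (by simp [hc, hd])]
      congr 1
      rw [hc, div_mul_eq_mul_div, ← add_div, zero_mul, zero_add]
    · rw [if_neg hc]
      have hinv : Tendsto (fun k : ℂ => k⁻¹) (cocompact ℂ) (𝓝 0) := by
        rw [← Metric.cobounded_eq_cocompact]
        exact tendsto_inv₀_cobounded
      have h1 : Tendsto (fun k : ℂ => (g 0 0 + g 0 1 * k⁻¹) / (g 1 0 + g 1 1 * k⁻¹)) (cocompact ℂ)
          (𝓝 ((g 0 0 + g 0 1 * 0) / (g 1 0 + g 1 1 * 0))) :=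
        Tendsto.div (tendsto_const_nhds.add (tendsto_const_nhds.mul hinv))
          (tendsto_const_nhds.add (tendsto_const_nhds.mul hinv)) (by simpa using hc)
      simp only [mul_zero, add_zero] at h1
      have h2 := ((OnePoint.continuous_coe (X := ℂ)).tendsto (g 0 0 / g 1 0)).comp h1
      refine h2.congr' ?_
      have hne : ∀ᶠ k : ℂ in cocompact ℂ, k ≠ 0 :=
        (isCompact_singleton (x := (0 : ℂ))).compl_mem_cocompact
      have hne2 : ∀ᶠ k : ℂ in cocompact ℂ, k ≠ -g 1 1 / g 1 0 :=
        (isCompact_singleton (x := (-g 1 1 / g 1 0 : ℂ))).compl_mem_cocompact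
      filter_upwards [hne, hne2] with k hk hk2
      have hk3 : g 1 0 * k + g 1 1 ≠ 0 := by
        intro h
        apply hk2
        rw [eq_div_iff hc]
        linear_combination h
      simp only [Function.comp_apply]
      rw [OnePoint.smul_some_eq_ite, if_neg hk3]
      congr 1
      have hk4 : g 1 0 + g 1 1 * k⁻¹ ≠ 0 := by
        intro h
        apply hk3
        field_simp at h
        linear_combination h
      rw [div_eq_div_iff hk4 hk3]
      field_simp
  | coe k =>
    rw [OnePoint.continuousAt_coe]
    by_cases hk : g 1 0 * k + g 1 1 = 0
    · rw [continuousAt_iff_punctured_nhds, Function.comp_apply, OnePoint.smul_some_eq_ite,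
        if_pos hk]
      have hc : g 1 0 ≠ 0 := by
        intro h
        simp [h] at hk
        simp [h, hk] at hdet
      have hnum : g 0 0 * k + g 0 1 ≠ 0 := by
        intro h
        apply hdet
        have : g 1 0 * (g 0 0 * g 1 1 - g 0 1 * g 1 0) = 0 := by
          linear_combination g 1 0 * g 0 0 * hk - g 1 0 * g 1 0 * h
        exact (mul_eq_zero.1 this).resolve_left hc
      have hden : Tendsto (fun x : ℂ => g 1 0 * x + g 1 1) (𝓝[≠] k) (𝓝[≠] 0) := by
        refine tendsto_nhdsWithin_iff.2 ⟨?_, ?_⟩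
        · have : ContinuousAt (fun x : ℂ => g 1 0 * x + g 1 1) k := by fun_prop
          have h := this.tendsto
          simp only [hk] at h
          exact h.mono_left nhdsWithin_le_nhds
        · filter_upwards [self_mem_nhdsWithin] with x hx h
          apply hx
          have h' : g 1 0 * x + g 1 1 = 0 := h
          have : g 1 0 * (x - k) = 0 := by linear_combination h' - hk
          exact sub_eq_zero.1 ((mul_eq_zero.1 this).resolve_left hc)
      have hinv := (Filter.tendsto_inv₀_nhdsNE_zero (α := ℂ)).comp hden
      have hnumt : Tendsto (fun x : ℂ => g 0 0 * x + g 0 1) (𝓝[≠] k) (𝓝 (g 0 0 * k + g 0 1)) := by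
        have : ContinuousAt (fun x : ℂ => g 0 0 * x + g 0 1) k := by fun_prop
        exact this.tendsto.mono_left nhdsWithin_le_nhds
      have hq : Tendsto (fun x : ℂ => (g 0 0 * x + g 0 1) * (g 1 0 * x + g 1 1)⁻¹) (𝓝[≠] k)
          (cocompact ℂ) := by
        rw [← Metric.cobounded_eq_cocompact, ← tendsto_norm_atTop_iff_cobounded]
        rw [← tendsto_norm_atTop_iff_cobounded] at hinv
        simp only [norm_mul]
        exact Tendsto.pos_mul_atTop (norm_pos_iff.2 hnum) hnumt.norm hinv
      have h2 := (OnePoint.tendsto_coe_infty (X := ℂ))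
      rw [Filter.coclosedCompact_eq_cocompact] at h2
      refine (h2.comp hq).congr' ?_
      have hden' : ∀ᶠ x in 𝓝[≠] k, g 1 0 * x + g 1 1 ≠ 0 :=
        (tendsto_nhdsWithin_iff.1 hden).2
      filter_upwards [hden'] with x hx
      simp only [Function.comp_apply]
      rw [OnePoint.smul_some_eq_ite, if_neg hx, div_eq_mul_inv]
    · have h1 : ContinuousAt (fun x : ℂ => (g 0 0 * x + g 0 1) / (g 1 0 * x + g 1 1)) k :=
        ContinuousAt.div (by fun_prop) (by fun_prop) hk
      have h2 : ContinuousAt (fun x : ℂ =>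
          (((g 0 0 * x + g 0 1) / (g 1 0 * x + g 1 1) : ℂ) : Sphere)) k :=
        (OnePoint.continuous_coe (X := ℂ)).continuousAt.comp h1
      refine h2.congr ?_
      have hden' : ∀ᶠ x in 𝓝 k, g 1 0 * x + g 1 1 ≠ 0 := by
        have : ContinuousAt (fun x : ℂ => g 1 0 * x + g 1 1) k := by fun_prop
        exact this.eventually_ne hk
      filter_upwards [hden'] with x hx
      simp only [Function.comp_apply]
      rw [OnePoint.smul_some_eq_ite, if_neg hx]

/-- A Moebius transformation, as a homeomorphism of the Riemann sphere. -/
noncomputable def moebius (g : GL (Fin 2) ℂ) : Sphere ≃ₜ Sphere where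
  toEquiv := MulAction.toPerm g
  continuous_toFun := continuous_moebius g
  continuous_invFun := continuous_moebius g⁻¹

@[simp] theorem moebius_apply (g : GL (Fin 2) ℂ) (z : Sphere) : moebius g z = g • z := rfl

/-- Moebius transformations act transitively on triples of distinct points. -/
theorem exists_moebius (p : Fin 3 → Sphere) (hp : Function.Injective p) :
    ∃ g : GL (Fin 2) ℂ, g • p 0 = ((0 : ℂ) : Sphere) ∧ g • p 1 = ((1 : ℂ) : Sphere) ∧
      g • p 2 = OnePoint.infty := by
  have h01 : p 0 ≠ p 1 := fun h => absurd (hp h) (by decide)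
  have h02 : p 0 ≠ p 2 := fun h => absurd (hp h) (by decide)
  have h12 : p 1 ≠ p 2 := fun h => absurd (hp h) (by decide)
  generalize p 0 = a at *
  generalize p 1 = b at *
  generalize p 2 = c at *
  have key : ∀ M : Matrix (Fin 2) (Fin 2) ℂ, M.det ≠ 0 → ∃ g : GL (Fin 2) ℂ, ∀ i j, g i j = M i j :=
    fun M hM => ⟨Matrix.GeneralLinearGroup.mkOfDetNeZero M hM, fun _ _ => rfl⟩
  induction c using OnePoint.rec with
  | infty =>
    induction a using OnePoint.rec with
    | infty => exact absurd rfl h02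
    | coe a =>
      induction b using OnePoint.rec with
      | infty => exact absurd rfl h12
      | coe b =>
        have hab : b - a ≠ 0 := fun h => h01 (by rw [sub_eq_zero.1 h])
        obtain ⟨g, hg⟩ := key !![1, -a; 0, b - a] (by simpa [Matrix.det_fin_two] using hab)
        refine ⟨g, ?_, ?_, ?_⟩
        · rw [OnePoint.smul_some_eq_ite]; simp [hg, hab]
        · rw [OnePoint.smul_some_eq_ite]
          simp only [hg]
          simp [hab, ← sub_eq_add_neg]
        · rw [OnePoint.smul_infty_eq_ite]; simp [hg]
  | coe c =>
    induction a using OnePoint.rec with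
    | infty =>
      induction b using OnePoint.rec with
      | infty => exact absurd rfl h01
      | coe b =>
        have hbc : b - c ≠ 0 := fun h => h12 (by rw [sub_eq_zero.1 h])
        obtain ⟨g, hg⟩ := key !![0, b - c; 1, -c] (by
          rw [Matrix.det_fin_two]
          simpa [sub_eq_zero, eq_comm] using hbc)
        refine ⟨g, ?_, ?_, ?_⟩
        · rw [OnePoint.smul_infty_eq_ite]; simp [hg]
        · rw [OnePoint.smul_some_eq_ite]; simp [hg, hbc, ← sub_eq_add_neg]
        · rw [OnePoint.smul_some_eq_ite]; simp [hg]
    | coe a =>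
      have hac : a - c ≠ 0 := fun h => h02 (by rw [sub_eq_zero.1 h])
      induction b using OnePoint.rec with
      | infty =>
        obtain ⟨g, hg⟩ := key !![1, -a; 1, -c] (by
          simpa [Matrix.det_fin_two, add_comm, ← sub_eq_add_neg] using hac)
        refine ⟨g, ?_, ?_, ?_⟩
        · rw [OnePoint.smul_some_eq_ite]; simp [hg, hac, ← sub_eq_add_neg]
        · rw [OnePoint.smul_infty_eq_ite]; simp [hg]
        · rw [OnePoint.smul_some_eq_ite]; simp [hg]
      | coe b =>
        have hab : b - a ≠ 0 := fun h => h01 (by rw [sub_eq_zero.1 h])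
        have hbc : b - c ≠ 0 := fun h => h12 (by rw [sub_eq_zero.1 h])
        obtain ⟨g, hg⟩ := key !![b - c, -a * (b - c); b - a, -c * (b - a)] (by
          have : (b - c) * (b - a) * (a - c) ≠ 0 := mul_ne_zero (mul_ne_zero hbc hab) hac
          rw [Matrix.det_fin_two]
          simp only [Matrix.of_apply, Matrix.cons_val', Matrix.cons_val_zero, Matrix.cons_val_one,
            Matrix.cons_val_fin_one]
          intro h
          apply this
          linear_combination h)
        refine ⟨g, ?_, ?_, ?_⟩
        · rw [OnePoint.smul_some_eq_ite]
          simp only [hg]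
          have h1 : (b - a) * a + -c * (b - a) ≠ 0 := by
            have := mul_ne_zero hab hac
            intro h; apply this; linear_combination h
          have h2 : (b - c) * a + -a * (b - c) = 0 := by ring
          simp [h1, h2, -neg_mul]
        · rw [OnePoint.smul_some_eq_ite]
          simp only [hg]
          have h1 : (b - a) * b + -c * (b - a) ≠ 0 := by
            have := mul_ne_zero hab hbc
            intro h; apply this; linear_combination h
          have h2 : (b - c) * b + -a * (b - c) = (b - a) * b + -c * (b - a) := by ring
          simp [h1, h2, -neg_mul]
        · rw [OnePoint.smul_some_eq_ite]
          simp only [hg]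
          have h2 : (b - a) * c + -c * (b - a) = 0 := by ring
          simp [h2, -neg_mul]

/-- A Moebius transformation that fixes `0`, `1` and `∞` is the identity. -/
theorem moebius_unique (g : GL (Fin 2) ℂ) (h0 : g • ((0 : ℂ) : Sphere) = ((0 : ℂ) : Sphere))
    (h1 : g • ((1 : ℂ) : Sphere) = ((1 : ℂ) : Sphere))
    (hi : g • (OnePoint.infty : Sphere) = OnePoint.infty) (z : Sphere) : g • z = z := by
  have hc : g 1 0 = 0 := OnePoint.smul_infty_eq_self_iff.1 hi
  have hdet : g 0 0 * g 1 1 - g 0 1 * g 1 0 ≠ 0 := by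
    have := g.det_ne_zero
    rwa [Matrix.det_fin_two] at this
  have hd : g 1 1 ≠ 0 := by rintro h; simp [h, hc] at hdet
  rw [OnePoint.smul_some_eq_ite, if_neg (by simpa [hc] using hd), OnePoint.coe_eq_coe] at h0 h1
  have hb : g 0 1 = 0 := by simpa [hc, hd] using h0
  have ha : g 0 0 = g 1 1 := by
    have : g 0 0 / g 1 1 = 1 := by simpa [hc, hb] using h1
    exact (div_eq_one_iff_eq hd).1 this
  induction z using OnePoint.rec with
  | infty => exact hi
  | coe z =>
    rw [OnePoint.smul_some_eq_ite, if_neg (by simpa [hc] using hd), hc, hb, ha]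
    congr 1
    rw [zero_mul, zero_add, add_zero, mul_div_right_comm, div_self hd, one_mul]

/-- A topological sphere with a projective structure: a topological space with a class of
homeomorphisms onto the Riemann sphere (the projective charts) that is one full equivalence class
for the relation of differing by a Moebius transformation. -/
structure ProjectiveSphere where
  /-- The underlying space. -/
  carrier : Type
  [top : TopologicalSpace carrier]
  /-- The projective charts. -/
  charts : Set (carrier ≃ₜ Sphere)
  charts_nonempty : charts.Nonempty
  mem_charts_iff : ∀ σ ∈ charts, ∀ τ : carrier ≃ₜ Sphere,
    τ ∈ charts ↔ ∃ g : GL (Fin 2) ℂ, ∀ p, τ p = g • σ p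

attribute [instance] ProjectiveSphere.top

/-- The Riemann sphere with its standard projective structure. -/
noncomputable def ProjectiveSphere.standard : ProjectiveSphere where
  carrier := Sphere
  charts := Set.range moebius
  charts_nonempty := Set.range_nonempty _
  mem_charts_iff := by
    rintro _ ⟨g, rfl⟩ τ
    constructor
    · rintro ⟨h, rfl⟩
      exact ⟨h * g⁻¹, fun p => by simp [mul_smul]⟩
    · rintro ⟨h, hh⟩
      exact ⟨h * g, by ext p; simp [hh, mul_smul]⟩

/-- Isomorphisms of projective spheres: the homeomorphisms that pull charts back to charts. -/
def IsProjective {S S' : ProjectiveSphere} (f : S.carrier ≃ₜ S'.carrier) : Prop :=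
  ∀ σ ∈ S'.charts, f.trans σ ∈ S.charts

theorem IsProjective.symm {S S' : ProjectiveSphere} {f : S.carrier ≃ₜ S'.carrier}
    (hf : IsProjective f) : IsProjective (S := S') (S' := S) f.symm := by
  intro σ hσ
  obtain ⟨τ, hτ⟩ := S'.charts_nonempty
  obtain ⟨g, hg⟩ := (S.mem_charts_iff _ (hf τ hτ) σ).1 hσ
  refine (S'.mem_charts_iff τ hτ _).2 ⟨g, fun p => ?_⟩
  simp [hg]

/-- Three distinct points of a projective sphere are sent to `0`, `1`, `∞` by a unique chart. -/
theorem ProjectiveSphere.existsUnique_chart (S : ProjectiveSphere) (p : Fin 3 → S.carrier)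
    (hp : Function.Injective p) :
    ∃! σ : S.carrier ≃ₜ Sphere, σ ∈ S.charts ∧ σ (p 0) = ((0 : ℂ) : Sphere) ∧
      σ (p 1) = ((1 : ℂ) : Sphere) ∧ σ (p 2) = OnePoint.infty := by
  obtain ⟨τ, hτ⟩ := S.charts_nonempty
  obtain ⟨g, h0, h1, h2⟩ := exists_moebius (fun k => τ (p k)) (τ.injective.comp hp)
  refine ⟨τ.trans (moebius g), ⟨(S.mem_charts_iff τ hτ _).2 ⟨g, fun _ => rfl⟩, h0, h1, h2⟩, ?_⟩
  rintro σ ⟨hσ, k0, k1, k2⟩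
  obtain ⟨k, hk⟩ := (S.mem_charts_iff _ ((S.mem_charts_iff τ hτ (τ.trans (moebius g))).2
    ⟨g, fun _ => rfl⟩) σ).1 hσ
  ext x
  rw [hk]
  apply moebius_unique
  · have e := hk (p 0)
    rw [k0, Homeomorph.trans_apply, moebius_apply, h0] at e
    exact e.symm
  · have e := hk (p 1)
    rw [k1, Homeomorph.trans_apply, moebius_apply, h1] at e
    exact e.symm
  · have e := hk (p 2)
    rw [k2, Homeomorph.trans_apply, moebius_apply, h2] at e
    exact e.symm

/-- The unique projective chart of `S` that maps `p 0`, `p 1`, `p 2` to `0`, `1`, `∞`. -/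
noncomputable def ProjectiveSphere.chart (S : ProjectiveSphere) (p : Fin 3 → S.carrier)
    (hp : Function.Injective p) : S.carrier ≃ₜ Sphere :=
  (S.existsUnique_chart p hp).choose

theorem ProjectiveSphere.chart_spec (S : ProjectiveSphere) (p : Fin 3 → S.carrier)
    (hp : Function.Injective p) :
    S.chart p hp ∈ S.charts ∧ S.chart p hp (p 0) = ((0 : ℂ) : Sphere) ∧
      S.chart p hp (p 1) = ((1 : ℂ) : Sphere) ∧ S.chart p hp (p 2) = OnePoint.infty :=
  (S.existsUnique_chart p hp).choose_spec.1

theorem ProjectiveSphere.eq_chart (S : ProjectiveSphere) (p : Fin 3 → S.carrier)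
    (hp : Function.Injective p) (σ : S.carrier ≃ₜ Sphere) (hσ : σ ∈ S.charts)
    (h0 : σ (p 0) = ((0 : ℂ) : Sphere)) (h1 : σ (p 1) = ((1 : ℂ) : Sphere))
    (h2 : σ (p 2) = OnePoint.infty) : σ = S.chart p hp :=
  (S.existsUnique_chart p hp).choose_spec.2 σ ⟨hσ, h0, h1, h2⟩

/-! ### Branches of a tree at a vertex -/

section Graph

variable {V : Type*} {G : SimpleGraph V}

/-- A walk that avoids `v` is a walk in the graph with `v` removed. -/
theorem reachable_of_walk {v a b : V} (p : G.Walk a b) (hp : v ∉ p.support) :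
    (G.deleteIncidenceSet v).Reachable a b := by
  induction p with
  | nil => exact SimpleGraph.Reachable.refl _
  | cons h p ih =>
    rw [SimpleGraph.Walk.support_cons, List.mem_cons, not_or] at hp
    refine SimpleGraph.Reachable.trans (SimpleGraph.Adj.reachable ?_) (ih hp.2)
    rw [SimpleGraph.deleteIncidenceSet_adj]
    exact ⟨h, fun h => hp.1 h.symm, fun h => hp.2 (h ▸ p.start_mem_support)⟩

/-- Reachability off `v` gives a path that avoids `v`. -/
theorem exists_path_of_reachable {v a b : V} (ha : a ≠ v)
    (h : (G.deleteIncidenceSet v).Reachable a b) :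
    ∃ p : G.Walk a b, p.IsPath ∧ v ∉ p.support := by
  obtain ⟨p, hp⟩ := h.exists_isPath
  have key : ∀ {a b : V} (p : (G.deleteIncidenceSet v).Walk a b), a ≠ v → v ∉ p.support := by
    intro a b p
    induction p with
    | nil => intro h; simpa using h.symm
    | cons h p ih =>
      intro ha
      rw [SimpleGraph.deleteIncidenceSet_adj] at h
      rw [SimpleGraph.Walk.support_cons, List.mem_cons, not_or]
      exact ⟨ha.symm, ih h.2.2⟩
  refine ⟨p.mapLe (G.deleteIncidenceSet_le v), ?_, ?_⟩
  · simpa using hp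
  · simpa using key p ha

/-- In a tree, each `x ≠ v` lies in the component of a unique neighbour of `v` in the graph with
`v` removed. -/
theorem existsUnique_branch (hG : G.IsTree) {v x : V} (hx : x ≠ v) :
    ∃! w : G.neighborSet v, (G.deleteIncidenceSet v).Reachable (w : V) x := by
  obtain ⟨p, hp, -⟩ := hG.existsUnique_path v x
  cases p with
  | nil => exact absurd rfl hx
  | @cons _ w _ h p =>
    rw [SimpleGraph.Walk.cons_isPath_iff] at hp
    refine ⟨⟨w, h⟩, reachable_of_walk p hp.2, ?_⟩
    rintro ⟨w', h'⟩ hr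
    obtain ⟨q, hq, hvq⟩ := exists_path_of_reachable (G.ne_of_adj h').symm hr
    have := (hG.existsUnique_path v x).unique
      (SimpleGraph.Walk.cons_isPath_iff h' q |>.2 ⟨hq, hvq⟩)
      (SimpleGraph.Walk.cons_isPath_iff h p |>.2 hp)
    injection this with _ h1
    exact Subtype.ext h1

/-- In a tree, moving from `v` to its neighbour on the side of `x` decreases the distance
to `x`. -/
theorem dist_branch (hG : G.IsTree) {v w x : V} (h : G.Adj v w)
    (hr : (G.deleteIncidenceSet v).Reachable w x) : G.dist v x = G.dist w x + 1 := by
  obtain ⟨q, hq, hvq⟩ := exists_path_of_reachable (G.ne_of_adj h).symm hr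
  have hc := SimpleGraph.Walk.cons_isPath_iff h q |>.2 ⟨hq, hvq⟩
  obtain ⟨p, hp, hpl⟩ := hG.1.exists_path_of_dist v x
  obtain ⟨q', hq', hql⟩ := hG.1.exists_path_of_dist w x
  rw [← hpl, ← hql, (hG.existsUnique_path v x).unique hp hc,
    (hG.existsUnique_path w x).unique hq' hq, SimpleGraph.Walk.length_cons]

end Graph

/-! ### Trees of spheres -/

/-- A stable tree of spheres marked by `X`. The vertices of the combinatorial tree are its leaves,
which are the elements `Sum.inl x` with `x : X`, and its internal vertices `Sum.inr v`. An edge at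
`v` is given by its other end, an element of the set of neighbours of `v`. -/
structure TreeOfSpheres (X : Type u) : Type (max u 1) where
  /-- The internal vertices. -/
  Internal : Type
  finite_internal : Finite Internal
  /-- The combinatorial tree. -/
  graph : SimpleGraph (X ⊕ Internal)
  isTree : graph.IsTree
  leaf_degree : ∀ x : X, (graph.neighborSet (Sum.inl x)).encard = 1
  /-- Stability. -/
  internal_degree : ∀ v : Internal, 3 ≤ (graph.neighborSet (Sum.inr v)).encard
  /-- The projective sphere at an internal vertex. -/
  sphere : Internal → ProjectiveSphere
  /-- The injection of the edges at an internal vertex into its sphere. -/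
  attach : ∀ v : Internal, graph.neighborSet (Sum.inr v) → (sphere v).carrier
  attach_injective : ∀ v, Function.Injective (attach v)

namespace TreeOfSpheres

variable {X : Type u}

/-- The edge at the internal vertex `v` that lies in the same component as the leaf `x` once `v`
is removed. -/
noncomputable def branch (T : TreeOfSpheres X) (v : T.Internal) (x : X) :
    T.graph.neighborSet (Sum.inr v) :=
  (existsUnique_branch T.isTree (v := Sum.inr v) (x := Sum.inl x) Sum.inl_ne_inr).choose

theorem branch_spec (T : TreeOfSpheres X) (v : T.Internal) (x : X) :
    (T.graph.deleteIncidenceSet (Sum.inr v)).Reachable (T.branch v x : X ⊕ T.Internal)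
      (Sum.inl x) :=
  (existsUnique_branch T.isTree (v := Sum.inr v) (x := Sum.inl x) Sum.inl_ne_inr).choose_spec.1

theorem eq_branch (T : TreeOfSpheres X) (v : T.Internal) (x : X)
    (w : T.graph.neighborSet (Sum.inr v))
    (h : (T.graph.deleteIncidenceSet (Sum.inr v)).Reachable (w : X ⊕ T.Internal) (Sum.inl x)) :
    w = T.branch v x :=
  (existsUnique_branch T.isTree (v := Sum.inr v) (x := Sum.inl x)
    Sum.inl_ne_inr).choose_spec.2 w h

/-- The map `a_v : X → 𝒮_v` of an internal vertex `v`. -/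
noncomputable def marking (T : TreeOfSpheres X) (v : T.Internal) (x : X) : (T.sphere v).carrier :=
  T.attach v (T.branch v x)

/-- The internal vertex `v` separates the triple `t` if the three leaves lie in three different
components of the tree with `v` removed. -/
def Separates (T : TreeOfSpheres X) (v : T.Internal) (t : Fin 3 ↪ X) : Prop :=
  ∀ j k : Fin 3, j ≠ k →
    ¬ (T.graph.deleteIncidenceSet (Sum.inr v)).Reachable (Sum.inl (t j)) (Sum.inl (t k))

theorem Separates.injective {T : TreeOfSpheres X} {v : T.Internal} {t : Fin 3 ↪ X}
    (h : T.Separates v t) : Function.Injective fun k => T.marking v (t k) := by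
  intro j k hjk
  by_contra hne
  have hb : T.branch v (t j) = T.branch v (t k) := T.attach_injective v hjk
  refine h j k hne ((T.branch_spec v (t j)).symm.trans ?_)
  rw [hb]
  exact T.branch_spec v (t k)

/-- A triple of distinct leaves is separated by an internal vertex. -/
theorem exists_separates (T : TreeOfSpheres X) (t : Fin 3 ↪ X) : ∃ v, T.Separates v t := by
  let f : X ⊕ T.Internal → ℕ := fun v => ∑ k, T.graph.dist v (Sum.inl (t k))
  have key : ∀ v w : X ⊕ T.Internal, T.graph.Adj v w → ∀ j k : Fin 3, j ≠ k →
      (T.graph.deleteIncidenceSet v).Reachable w (Sum.inl (t j)) →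
      (T.graph.deleteIncidenceSet v).Reachable w (Sum.inl (t k)) → f w < f v := by
    intro v w hvw j k hjk hj hk
    have h1 := dist_branch T.isTree hvw hj
    have h2 := dist_branch T.isTree hvw hk
    have h3 : ∀ l, T.graph.dist w (Sum.inl (t l)) ≤ 1 + T.graph.dist v (Sum.inl (t l)) := by
      intro l
      have := T.isTree.1.dist_triangle (u := w) (v := v) (w := Sum.inl (t l))
      rwa [SimpleGraph.dist_eq_one_iff_adj.2 hvw.symm] at this
    have e0 := h3 0
    have e1 := h3 1
    have e2 := h3 2
    simp only [f, Fin.sum_univ_three]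
    fin_cases j <;> fin_cases k <;> simp at hjk h1 h2 <;> omega
  obtain ⟨v, hv⟩ : ∃ v, ∀ w, f v ≤ f w := by
    have : Nonempty (X ⊕ T.Internal) := T.isTree.1.nonempty
    exact ⟨Function.argmin f, fun w => Function.argmin_le f w⟩
  rcases v with x | v
  · exfalso
    obtain ⟨w, hw⟩ := Set.encard_eq_one.1 (T.leaf_degree x)
    have hxw : T.graph.Adj (Sum.inl x) w := by
      have : w ∈ T.graph.neighborSet (Sum.inl x) := by rw [hw]; rfl
      exact this
    have hall : ∀ k, t k ≠ x →
        (T.graph.deleteIncidenceSet (Sum.inl x)).Reachable w (Sum.inl (t k)) := by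
      intro k hk
      obtain ⟨⟨w', hw'⟩, h, -⟩ := existsUnique_branch T.isTree (v := Sum.inl x)
        (x := Sum.inl (t k)) (fun h => hk (Sum.inl_injective h))
      have hm := hw'
      rw [hw] at hm
      rw [← Set.mem_singleton_iff.1 hm]
      exact h
    have hne : ∀ j k, t j = x → t k = x → j = k := fun j k hj hk => t.injective (hj.trans hk.symm)
    obtain ⟨j, k, hjk, hj, hk⟩ : ∃ j k, j ≠ k ∧ t j ≠ x ∧ t k ≠ x := by
      by_cases h0 : t 0 = x
      · exact ⟨1, 2, by decide, fun h => absurd (hne _ _ h h0) (by decide),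
          fun h => absurd (hne _ _ h h0) (by decide)⟩
      · by_cases h1 : t 1 = x
        · exact ⟨0, 2, by decide, h0, fun h => absurd (hne _ _ h h1) (by decide)⟩
        · exact ⟨0, 1, by decide, h0, h1⟩
    exact absurd (hv w) (not_le.2 (key _ _ hxw j k hjk (hall j hj) (hall k hk)))
  · refine ⟨v, fun j k hjk hr => ?_⟩
    exact absurd (hv _) (not_le.2 (key _ _ (T.branch v (t j)).2 j k hjk (T.branch_spec v (t j))
      ((T.branch_spec v (t j)).trans hr)))

/-- The vertex that separates a triple is unique. -/
theorem Separates.unique {T : TreeOfSpheres X} {v v' : T.Internal} {t : Fin 3 ↪ X}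
    (h : T.Separates v t) (h' : T.Separates v' t) : v = v' := by
  classical
  by_contra hne
  have hne' : (Sum.inr v : X ⊕ T.Internal) ≠ Sum.inr v' := fun e => hne (Sum.inr_injective e)
  choose p hp _ using fun k => T.isTree.existsUnique_path (Sum.inr v) (Sum.inl (t k))
  have hmem : ∀ k, Sum.inr v' ∈ (p k).support →
      (T.graph.deleteIncidenceSet (Sum.inr v)).Reachable (Sum.inr v') (Sum.inl (t k)) := by
    intro k hk
    refine reachable_of_walk ((p k).dropUntil _ hk) ?_
    intro hv
    have hpk := hp k
    rw [← (p k).take_spec hk, SimpleGraph.Walk.isPath_def, SimpleGraph.Walk.support_append] at hpk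
    have hdis := List.nodup_append.1 hpk
    refine hdis.2.2 _ (SimpleGraph.Walk.start_mem_support _) _ ?_ rfl
    rw [SimpleGraph.Walk.mem_support_iff] at hv
    exact hv.resolve_left hne'
  have hnot : ∀ k, Sum.inr v' ∉ (p k).support →
      (T.graph.deleteIncidenceSet (Sum.inr v')).Reachable (Sum.inr v) (Sum.inl (t k)) :=
    fun k hk => reachable_of_walk (p k) hk
  have hone : ∀ j k, j ≠ k → Sum.inr v' ∈ (p j).support → Sum.inr v' ∉ (p k).support :=
    fun j k hjk hj hk => h j k hjk ((hmem j hj).symm.trans (hmem k hk))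
  have htwo : ∀ j k, j ≠ k → Sum.inr v' ∉ (p j).support → Sum.inr v' ∈ (p k).support :=
    fun j k hjk hj => by
      by_contra hk
      exact h' j k hjk ((hnot j hj).symm.trans (hnot k hk))
  by_cases h0 : Sum.inr v' ∈ (p 0).support
  · exact hone 0 2 (by decide) h0 (htwo 1 2 (by decide) (hone 0 1 (by decide) h0))
  · exact hone 1 2 (by decide) (htwo 0 1 (by decide) h0) (htwo 0 2 (by decide) h0)

/-- The internal vertex that separates the triple `t`. -/
noncomputable def vertex (T : TreeOfSpheres X) (t : Fin 3 ↪ X) : T.Internal :=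
  (T.exists_separates t).choose

theorem vertex_spec (T : TreeOfSpheres X) (t : Fin 3 ↪ X) : T.Separates (T.vertex t) t :=
  (T.exists_separates t).choose_spec

/-- The `t`-chart `σ_t`: the projective chart of the sphere of the vertex `v` that separates `t`
with `σ_t (a_v (t 0)) = 0`, `σ_t (a_v (t 1)) = 1`, `σ_t (a_v (t 2)) = ∞`. -/
noncomputable def tChart (T : TreeOfSpheres X) (t : Fin 3 ↪ X) :
    (T.sphere (T.vertex t)).carrier ≃ₜ Sphere :=
  (T.sphere (T.vertex t)).chart (fun k => T.marking (T.vertex t) (t k)) (T.vertex_spec t).injective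

/-- The marking `α_t = σ_t ∘ a_v` of the `t`-chart. -/
noncomputable def tMarking (T : TreeOfSpheres X) (t : Fin 3 ↪ X) (x : X) : Sphere :=
  T.tChart t (T.marking (T.vertex t) x)

/-! ### Isomorphisms and the moduli space -/

/-- For a map `φ` of combinatorial trees that sends `v` to `v'`: there is an isomorphism
of projective spheres `𝒮_v → 𝒮_v'` that maps the attaching point of every edge `{v, w}` to that of
the edge `{v', φ w}`. -/
def SphereIso (T T' : TreeOfSpheres X) (φ : X ⊕ T.Internal → X ⊕ T'.Internal)
    (v : T.Internal) (v' : T'.Internal) : Prop :=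
  ∃ f : (T.sphere v).carrier ≃ₜ (T'.sphere v').carrier, IsProjective f ∧
    ∀ (w : T.graph.neighborSet (Sum.inr v)) (w' : T'.graph.neighborSet (Sum.inr v')),
      φ (w : X ⊕ T.Internal) = w' → f (T.attach v w) = T'.attach v' w'

/-- Isomorphism of trees of spheres marked by `X`: an isomorphism of the combinatorial trees that is
the identity on `X` (given by a bijection `e` of the internal vertices), together with projective
isomorphisms of the spheres that respect the attaching points of the edges. -/
def Isomorphic (T T' : TreeOfSpheres X) : Prop :=
  ∃ e : T.Internal ≃ T'.Internal,
    (∀ a b, T'.graph.Adj (Equiv.sumCongr (Equiv.refl X) e a) (Equiv.sumCongr (Equiv.refl X) e b) ↔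
      T.graph.Adj a b) ∧
    ∀ v, SphereIso T T' (Equiv.sumCongr (Equiv.refl X) e) v (e v)

theorem Isomorphic.refl (T : TreeOfSpheres X) : Isomorphic T T := by
  refine ⟨Equiv.refl _, by simp, fun v => ⟨Homeomorph.refl _, fun σ hσ => hσ, ?_⟩⟩
  intro w w' h
  have : w = w' := Subtype.ext (by simpa using h)
  subst this
  rfl

theorem Isomorphic.symm {T T' : TreeOfSpheres X} (h : Isomorphic T T') : Isomorphic T' T := by
  obtain ⟨e, he, hf⟩ := h
  have hsymm : ∀ a, (Equiv.sumCongr (Equiv.refl X) e)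
      ((Equiv.sumCongr (Equiv.refl X) e.symm) a) = a := by
    rintro (a | a) <;> simp
  refine ⟨e.symm, fun a b => ?_, fun v' => ?_⟩
  · rw [← he, hsymm, hsymm]
  · have := hf (e.symm v')
    rw [e.apply_symm_apply] at this
    obtain ⟨f, hf1, hf2⟩ := this
    refine ⟨f.symm, hf1.symm, fun w w' hw => ?_⟩
    rw [Homeomorph.symm_apply_eq]
    symm
    apply hf2
    rw [← hw, hsymm]

theorem Isomorphic.trans {T T' T'' : TreeOfSpheres X} (h : Isomorphic T T')
    (h' : Isomorphic T' T'') : Isomorphic T T'' := by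
  obtain ⟨e, he, hf⟩ := h
  obtain ⟨e', he', hf'⟩ := h'
  have htrans : ∀ a, (Equiv.sumCongr (Equiv.refl X) (e.trans e')) a =
      (Equiv.sumCongr (Equiv.refl X) e') ((Equiv.sumCongr (Equiv.refl X) e) a) := by
    rintro (a | a) <;> simp
  refine ⟨e.trans e', fun a b => by rw [htrans, htrans, he', he], fun v => ?_⟩
  obtain ⟨f, hf1, hf2⟩ := hf v
  obtain ⟨g, hg1, hg2⟩ := hf' (e v)
  refine ⟨f.trans g, fun σ hσ => hf1 _ (hg1 σ hσ), fun w w'' hw => ?_⟩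
  have hadj : T'.graph.Adj (Sum.inr (e v)) (Equiv.sumCongr (Equiv.refl X) e w) := by
    have := (he (Sum.inr v) w).2 w.2
    simpa using this
  have h1 := hf2 w ⟨_, hadj⟩ rfl
  have h2 := hg2 ⟨_, hadj⟩ w'' (by rw [← hw, htrans])
  exact (congrArg g h1).trans h2

/-- Isomorphism, as an equivalence relation on the trees of spheres marked by `X`. -/
instance isoSetoid (X : Type u) : Setoid (TreeOfSpheres X) where
  r := Isomorphic
  iseqv := ⟨Isomorphic.refl, Isomorphic.symm, Isomorphic.trans⟩

/-- Isomorphic trees of spheres have the same `t`-markings. -/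
theorem Isomorphic.tMarking_eq {T T' : TreeOfSpheres X} (h : Isomorphic T T') (t : Fin 3 ↪ X)
    (x : X) : T.tMarking t x = T'.tMarking t x := by
  obtain ⟨e, he, hf⟩ := h
  let E : X ⊕ T.Internal ≃ X ⊕ T'.Internal := Equiv.sumCongr (Equiv.refl X) e
  have hEinj : Function.Injective E := E.injective
  have hdel : ∀ v a b, (T'.graph.deleteIncidenceSet (Sum.inr (e v))).Adj (E a) (E b) ↔
      (T.graph.deleteIncidenceSet (Sum.inr v)).Adj a b := by
    intro v a b
    have hv : (Sum.inr (e v) : X ⊕ T'.Internal) = E (Sum.inr v) := by simp [E]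
    rw [SimpleGraph.deleteIncidenceSet_adj, SimpleGraph.deleteIncidenceSet_adj, hv, he,
      hEinj.ne_iff, hEinj.ne_iff]
  let I : ∀ v, T.graph.deleteIncidenceSet (Sum.inr v) ≃g
      T'.graph.deleteIncidenceSet (Sum.inr (e v)) := fun v => ⟨E, hdel v _ _⟩
  have hreach : ∀ v a b, (T'.graph.deleteIncidenceSet (Sum.inr (e v))).Reachable (E a) (E b) ↔
      (T.graph.deleteIncidenceSet (Sum.inr v)).Reachable a b :=
    fun v a b => (I v).reachable_iff
  have hsep : T'.Separates (e (T.vertex t)) t := by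
    intro j k hjk hr
    exact T.vertex_spec t j k hjk ((hreach _ (Sum.inl (t j)) (Sum.inl (t k))).1 hr)
  have hv : T'.vertex t = e (T.vertex t) := (T'.vertex_spec t).unique hsep
  obtain ⟨f, hf1, hf2⟩ := hf (T.vertex t)
  have hmark : ∀ y, f (T.marking (T.vertex t) y) = T'.marking (e (T.vertex t)) y := by
    intro y
    refine hf2 _ _ ?_
    have hadj : T'.graph.Adj (Sum.inr (e (T.vertex t))) (E (T.branch (T.vertex t) y)) := by
      exact (he (Sum.inr (T.vertex t)) _).2 (T.branch (T.vertex t) y).2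
    have := T'.eq_branch (e (T.vertex t)) y ⟨_, hadj⟩
      ((hreach _ _ (Sum.inl y)).2 (T.branch_spec (T.vertex t) y))
    rw [← this]
  have hgen : ∀ (v' : T'.Internal) (hs : T'.Separates v' t), T'.vertex t = v' →
      T'.tMarking t x = (T'.sphere v').chart (fun k => T'.marking v' (t k)) hs.injective
        (T'.marking v' x) := by
    rintro v' hs rfl
    rfl
  rw [hgen _ hsep hv]
  set σ := (T'.sphere (e (T.vertex t))).chart
    (fun k => T'.marking (e (T.vertex t)) (t k)) hsep.injective with hσ
  obtain ⟨k1, k2, k3, k4⟩ := (T'.sphere (e (T.vertex t))).chart_spec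
    (fun k => T'.marking (e (T.vertex t)) (t k)) hsep.injective
  have := (T.sphere (T.vertex t)).eq_chart (fun k => T.marking (T.vertex t) (t k))
    (T.vertex_spec t).injective (f.trans σ) (hf1 σ k1) (by simpa [hmark] using k2)
    (by simpa [hmark] using k3) (by simpa [hmark] using k4)
  rw [tMarking, tChart, ← this, Homeomorph.trans_apply, hmark]

end TreeOfSpheres

/-- Quadruples `(x₀, x₁, x_∞, x)` of distinct elements of `X`. -/
abbrev Quad (X : Type u) : Type u := Fin 4 ↪ X

/-- The triple `(x₀, x₁, x_∞)` of the quadruple `(x₀, x₁, x_∞, x)`. -/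
def Quad.triple {X : Type u} (q : Quad X) : Fin 3 ↪ X := Fin.castSuccEmb.trans q

/-- The moduli space of stable trees of spheres marked by `X`. -/
def ModuliTrees (X : Type u) : Type (max u 1) := Quotient (TreeOfSpheres.isoSetoid X)

/-- The map from the moduli space of trees of spheres to `𝕊 ^ Quad_X` that sends the class
of `T` to the collection of the `α_t(x)`. -/
noncomputable def crossRatioMap (X : Type u) : ModuliTrees X → Quad X → Sphere :=
  Quotient.lift (fun T q => T.tMarking q.triple (q 3))
    fun _ _ h => funext fun q => TreeOfSpheres.Isomorphic.tMarking_eq h q.triple (q 3)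

/-- The topology of the moduli space is the one defined by the cross-ratio map. -/
noncomputable instance instTopologicalSpaceModuliTrees (X : Type u) :
    TopologicalSpace (ModuliTrees X) :=
  TopologicalSpace.induced (crossRatioMap X) inferInstance

/-- The classes of marked spheres: trees of spheres with a unique internal vertex. -/
def smoothLocus (X : Type u) : Set (ModuliTrees X) :=
  {c | ∃ T : TreeOfSpheres X, Nat.card T.Internal = 1 ∧ c = Quotient.mk _ T}

/-- The cross-ratios of a sphere marked by an injection `i : X → 𝕊`: for a quadruple
`(x₀, x₁, x_∞, x)`, the image of `i x` under the Moebius transformation that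
maps `i x₀`, `i x₁`, `i x_∞` to `0`, `1`, `∞`. -/
noncomputable def markedSphereCrossRatios {X : Type u} (i : X ↪ Sphere) (q : Quad X) : Sphere :=
  ProjectiveSphere.standard.chart (fun k => i (q.triple k))
    (i.injective.comp q.triple.injective) (i (q 3))

end TreesOfSpheres

namespace TreesOfSpheres

/-! ### Homogeneous coordinates on the Riemann sphere -/

/-! The proof replaces both sides of the closure statement by one explicit closed set. A family of
cross-ratios is the same as a system of markings, one for each triple `t`, normalized to send `t` to
0, 1, ∞ (`extend`). Call two markings compatible if they differ by a Moebius transformation or if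
they degenerate as two different vertices of a tree do: off one fibre of the first, the second is
constant. This says that all the points `(α x, β x)` lie on one curve of bidegree (1,1), irreducible
in the first case and a union of two lines in the second. Such curves form a compact projective
space, so compatibility is a closed condition (`isClosed_setOf_compat`), and `compatibleFamilies` is
closed and contains the cross-ratios of all marked spheres.

Every compatible family is a limit of marked spheres. Choose a root `r`, put it at ∞ in one marking
per Moebius class, and add up the finite coordinates of these markings, each scaled by a power of
`ε` that grows with the number of marked points at ∞. As `ε` tends to 0 this gives marked spheres,
and a rescaling at each class recovers its marking (`RootedFamily.exists_rescaling`). Compatibility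
with these limits then identifies any limit of the cross-ratios
(`compatibleFamilies_subset_closure`).

Every compatible family also comes from a tree of spheres: the Moebius classes are the internal
vertices, and adjacency is read off the fibres (`TreeFamily.isTree`,
`compatibleFamilies_subset_range`). Conversely a tree has compatible markings, because seen from two
different vertices each leaf lies towards the other vertex at least once
(`TreeOfSpheres.crossRatioMap_mem`). Hence the image of the cross-ratio map is `compatibleFamilies`,
the closure of the marked spheres.

Injectivity holds because the markings determine the vertices as classes of triples, the edges
through the fibres, and the spheres through the charts (`TreeOfSpheres.isomorphic_of_tMarking_eq`).
Compactness and density follow from Tychonoff's theorem and the induced topology. -/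

/-- The point of the Riemann sphere with homogeneous coordinates `z`. -/
noncomputable def ofHomogeneous (z : ℂ × ℂ) : Sphere :=
  if z.2 = 0 then OnePoint.infty else ((z.1 / z.2 : ℂ) : Sphere)

theorem det_ne_zero_of_GL (g : GL (Fin 2) ℂ) : g 0 0 * g 1 1 - g 0 1 * g 1 0 ≠ 0 := by
  have := g.det_ne_zero
  rwa [Matrix.det_fin_two] at this

theorem exists_GL_of_det_ne_zero (a b c d : ℂ) (h : a * d - b * c ≠ 0) :
    ∃ g : GL (Fin 2) ℂ, g 0 0 = a ∧ g 0 1 = b ∧ g 1 0 = c ∧ g 1 1 = d :=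
  ⟨Matrix.GeneralLinearGroup.mkOfDetNeZero !![a, b; c, d] (by rwa [Matrix.det_fin_two_of]),
    rfl, rfl, rfl, rfl⟩

theorem ofHomogeneous_eq_iff {z w : ℂ × ℂ} (hz : z ≠ 0) (hw : w ≠ 0) :
    ofHomogeneous z = ofHomogeneous w ↔ z.1 * w.2 - z.2 * w.1 = 0 := by
  obtain ⟨z1, z2⟩ := z
  obtain ⟨w1, w2⟩ := w
  simp only [ne_eq, Prod.mk_eq_zero, not_and] at hz hw
  simp only [ofHomogeneous]
  by_cases h2 : z2 = 0 <;> by_cases k2 : w2 = 0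
  · simp [h2, k2]
  · simp only [h2, k2, if_true, if_false]
    have : z1 ≠ 0 := fun h => hz h h2
    simp [this, k2]
  · simp only [h2, k2, if_true, if_false]
    have : w1 ≠ 0 := fun h => hw h k2
    simp [this, h2]
  · simp only [h2, k2, if_false, OnePoint.coe_eq_coe]
    rw [div_eq_div_iff h2 k2, ← sub_eq_zero, mul_comm w1]

theorem smul_ofHomogeneous (g : GL (Fin 2) ℂ) {z : ℂ × ℂ} (hz : z ≠ 0) :
    g • ofHomogeneous z =
      ofHomogeneous (g 0 0 * z.1 + g 0 1 * z.2, g 1 0 * z.1 + g 1 1 * z.2) := by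
  obtain ⟨z1, z2⟩ := z
  simp only [ne_eq, Prod.mk_eq_zero, not_and] at hz
  simp only [ofHomogeneous]
  by_cases h2 : z2 = 0
  · have h1 : z1 ≠ 0 := fun h => hz h h2
    simp only [h2, if_true, OnePoint.smul_infty_eq_ite, mul_zero, add_zero, mul_eq_zero, h1,
      or_false]
    congr 2
    field_simp
  · have e : g 1 0 * (z1 / z2) + g 1 1 = (g 1 0 * z1 + g 1 1 * z2) / z2 := by field_simp
    have e' : g 0 0 * (z1 / z2) + g 0 1 = (g 0 0 * z1 + g 0 1 * z2) / z2 := by field_simp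
    simp only [h2, if_false, OnePoint.smul_some_eq_ite, e, e', div_eq_zero_iff, or_false]
    congr 2
    field_simp

/-- Off `z.2 = 0` this is continuity of division. At the remaining points the coordinates are
swapped, which on the sphere is the Moebius transformation `1 / z`. -/
theorem continuousAt_ofHomogeneous {z : ℂ × ℂ} (hz : z ≠ 0) : ContinuousAt ofHomogeneous z := by
  have key : ∀ w : ℂ × ℂ, w.2 ≠ 0 → ContinuousAt ofHomogeneous w := by
    intro w hw
    have h1 : ContinuousAt (fun w : ℂ × ℂ => w.1 / w.2) w :=
      ContinuousAt.div (by fun_prop) (by fun_prop) hw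
    refine ((OnePoint.continuous_coe (X := ℂ)).continuousAt.comp h1).congr ?_
    have : ∀ᶠ w' : ℂ × ℂ in 𝓝 w, w'.2 ≠ 0 :=
      (continuous_snd.continuousAt (x := w)).eventually_ne hw
    filter_upwards [this] with w' hw'
    simp [ofHomogeneous, hw']
  by_cases h2 : z.2 = 0
  · have h1 : z.1 ≠ 0 := fun h => hz (Prod.ext h h2)
    obtain ⟨g, g1, g2, g3, g4⟩ := exists_GL_of_det_ne_zero 0 1 1 0 (by simp)
    have h3 : ContinuousAt (fun w : ℂ × ℂ => ofHomogeneous w.swap) z :=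
      ContinuousAt.comp (key z.swap h1) continuous_swap.continuousAt
    refine ((continuous_moebius g).continuousAt.comp h3).congr ?_
    filter_upwards [isOpen_ne.mem_nhds hz] with w hw
    have hw' : w.swap ≠ 0 := fun h => hw (by simpa using congrArg Prod.swap h)
    rw [Function.comp_apply, smul_ofHomogeneous g hw', g1, g2, g3, g4]
    simp
  · exact key z h2

theorem exists_ofHomogeneous_eq (p : Sphere) : ∃ z : ℂ × ℂ, ‖z‖ = 1 ∧ ofHomogeneous z = p := by
  obtain ⟨z, hz, rfl⟩ : ∃ z : ℂ × ℂ, z ≠ 0 ∧ ofHomogeneous z = p := by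
    induction p using OnePoint.rec with
    | infty => exact ⟨(1, 0), by simp, by simp [ofHomogeneous]⟩
    | coe p => exact ⟨(p, 1), by simp, by simp [ofHomogeneous]⟩
  have hn : ‖z‖ ≠ 0 := norm_ne_zero_iff.2 hz
  have hn' : ((‖z‖ : ℂ))⁻¹ ≠ 0 := inv_ne_zero (by exact_mod_cast hn)
  refine ⟨((‖z‖ : ℂ))⁻¹ • z, ?_, ?_⟩
  · rw [norm_smul, norm_inv, Complex.norm_real, norm_norm, inv_mul_cancel₀ hn]
  · rw [ofHomogeneous_eq_iff (smul_ne_zero hn' hz) hz]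
    simp only [Prod.smul_fst, Prod.smul_snd, smul_eq_mul]
    ring

/-! ### Compatible markings -/

/-- Two markings of the Riemann sphere by `X` are compatible if they differ by a Moebius
transformation, or if outside one fibre of the first the second is constant. -/
def Compat {X : Type*} (α β : X → Sphere) : Prop :=
  (∃ g : GL (Fin 2) ℂ, ∀ x, β x = g • α x) ∨ ∃ a b, ∀ x, α x = a ∨ β x = b

/-- Compatible markings are those that lie on a common curve of bidegree `(1, 1)`. -/
theorem compat_iff {X : Type*} {z w : X → ℂ × ℂ} (hz : ∀ x, z x ≠ 0) (hw : ∀ x, w x ≠ 0) :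
    Compat (fun x => ofHomogeneous (z x)) (fun x => ofHomogeneous (w x)) ↔
      ∃ m : (ℂ × ℂ) × ℂ × ℂ, m ≠ 0 ∧ ∀ x,
        (m.1.1 * (z x).1 + m.1.2 * (z x).2) * (w x).2 -
          (m.2.1 * (z x).1 + m.2.2 * (z x).2) * (w x).1 = 0 := by
  have hne : ∀ (g : GL (Fin 2) ℂ) {z : ℂ × ℂ}, z ≠ 0 →
      ((g 0 0 * z.1 + g 0 1 * z.2, g 1 0 * z.1 + g 1 1 * z.2) : ℂ × ℂ) ≠ 0 := by
    intro g z hz h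
    have hd := det_ne_zero_of_GL g
    simp only [Prod.mk_eq_zero] at h
    apply hz
    refine Prod.ext ?_ ?_
    · have : (g 0 0 * g 1 1 - g 0 1 * g 1 0) * z.1 = 0 := by
        linear_combination g 1 1 * h.1 - g 0 1 * h.2
      exact (mul_eq_zero.1 this).resolve_left hd
    · have : (g 0 0 * g 1 1 - g 0 1 * g 1 0) * z.2 = 0 := by
        linear_combination g 0 0 * h.2 - g 1 0 * h.1
      exact (mul_eq_zero.1 this).resolve_left hd
  constructor
  · rintro (⟨g, hg⟩ | ⟨a, b, hab⟩)
    · refine ⟨((g 0 0, g 0 1), (g 1 0, g 1 1)), ?_, fun x => ?_⟩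
      · intro h
        simp only [Prod.mk_eq_zero] at h
        apply det_ne_zero_of_GL g
        rw [h.1.1, h.1.2]; ring
      · have := hg x
        rw [smul_ofHomogeneous g (hz x), eq_comm, ofHomogeneous_eq_iff (hne g (hz x)) (hw x)] at this
        exact this
    · obtain ⟨k, hk, rfl⟩ := exists_ofHomogeneous_eq a
      obtain ⟨v, hv, rfl⟩ := exists_ofHomogeneous_eq b
      have hk' : k ≠ 0 := norm_ne_zero_iff.1 (by rw [hk]; exact one_ne_zero)
      have hv' : v ≠ 0 := norm_ne_zero_iff.1 (by rw [hv]; exact one_ne_zero)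
      -- The rank-one matrix with image spanned by `v` and kernel spanned by `k`; its equation is
      -- the product of the equations of the two points.
      refine ⟨((v.1 * k.2, - v.1 * k.1), (v.2 * k.2, - v.2 * k.1)), ?_, fun x => ?_⟩
      · intro h
        simp only [Prod.mk_eq_zero, mul_eq_zero, neg_eq_zero] at h
        have h1 : v.1 = 0 ∨ k = 0 := by
          by_cases hv1 : v.1 = 0
          · exact Or.inl hv1
          · exact Or.inr (Prod.ext (h.1.2.resolve_left hv1) (h.1.1.resolve_left hv1))
        have h2 : v.2 = 0 ∨ k = 0 := by
          by_cases hv1 : v.2 = 0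
          · exact Or.inl hv1
          · exact Or.inr (Prod.ext (h.2.2.resolve_left hv1) (h.2.1.resolve_left hv1))
        exact hv' (Prod.ext (h1.resolve_right hk') (h2.resolve_right hk'))
      · rcases hab x with h | h
        · rw [ofHomogeneous_eq_iff (hz x) hk'] at h
          linear_combination (v.1 * (w x).2 - v.2 * (w x).1) * h
        · rw [ofHomogeneous_eq_iff (hw x) hv'] at h
          linear_combination -((z x).1 * k.2 - (z x).2 * k.1) * h
  · rintro ⟨⟨⟨p, q⟩, ⟨r, s⟩⟩, hm, h⟩
    -- An invertible matrix is a Moebius transformation. A nonzero singular one factors into an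
    -- image vector `v` and a kernel vector `k`, so the curve splits into two lines.
    by_cases hd : p * s - q * r = 0
    · right
      have hvk : ∃ v k : ℂ × ℂ, v ≠ 0 ∧ k ≠ 0 ∧ p = v.1 * k.2 ∧ q = -v.1 * k.1 ∧
          r = v.2 * k.2 ∧ s = -v.2 * k.1 := by
        by_cases hpq : p = 0 ∧ q = 0
        · refine ⟨(0, 1), (-s, r), by simp, ?_, by simp [hpq.1], by simp [hpq.2], by simp, by simp⟩
          intro hrs
          simp only [Prod.mk_eq_zero, neg_eq_zero] at hrs
          exact hm (by simp [hpq.1, hpq.2, hrs.1, hrs.2])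
        · by_cases hp : p = 0
          · have hq : q ≠ 0 := fun hq => hpq ⟨hp, hq⟩
            have hr : r = 0 := by
              rw [hp] at hd
              simpa [hq] using hd
            exact ⟨(1, s / q), (-q, 0), by simp, by simpa using hq, by simp [hp], by simp,
              by simp [hr], by field_simp⟩
          · refine ⟨(1, r / p), (-q, p), by simp, by simp [hp], by simp, by simp, by field_simp, ?_⟩
            field_simp
            linear_combination hd
      obtain ⟨v, k, hv, hk, rfl, rfl, rfl, rfl⟩ := hvk
      refine ⟨ofHomogeneous k, ofHomogeneous v, fun x => ?_⟩
      rw [ofHomogeneous_eq_iff (hz x) hk, ofHomogeneous_eq_iff (hw x) hv, ← mul_eq_zero]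
      have := h x
      simp only at this
      linear_combination -this
    · left
      obtain ⟨g, rfl, rfl, rfl, rfl⟩ := exists_GL_of_det_ne_zero p q r s hd
      refine ⟨g, fun x => ?_⟩
      rw [smul_ofHomogeneous g (hz x), eq_comm, ofHomogeneous_eq_iff (hne g (hz x)) (hw x)]
      exact h x

/-- By homogeneity the coefficients of the curve and the coordinates of all points can be taken of
norm 1. The compatible pairs are then the continuous image of a closed subset of a product of unit
spheres, which is compact. -/
theorem isClosed_setOf_compat (X : Type*) :
    IsClosed {p : (X → Sphere) × (X → Sphere) | Compat p.1 p.2} := by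
  let N : Set (((ℂ × ℂ) × ℂ × ℂ) × (X → ℂ × ℂ) × (X → ℂ × ℂ)) :=
    Metric.sphere 0 1 ×ˢ
      (Set.univ.pi fun _ => Metric.sphere 0 1) ×ˢ (Set.univ.pi fun _ => Metric.sphere 0 1)
  let C : Set (((ℂ × ℂ) × ℂ × ℂ) × (X → ℂ × ℂ) × (X → ℂ × ℂ)) :=
    {y | ∀ x, (y.1.1.1 * (y.2.1 x).1 + y.1.1.2 * (y.2.1 x).2) * (y.2.2 x).2 -
          (y.1.2.1 * (y.2.1 x).1 + y.1.2.2 * (y.2.1 x).2) * (y.2.2 x).1 = 0}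
  have hN : IsCompact N := (isCompact_sphere _ _).prod
    ((isCompact_univ_pi fun _ => isCompact_sphere _ _).prod
      (isCompact_univ_pi fun _ => isCompact_sphere _ _))
  have hC : IsClosed C := by
    simp only [C, Set.ofPred_forall]
    exact isClosed_iInter fun x => isClosed_eq (by fun_prop) continuous_const
  let F : ((ℂ × ℂ) × ℂ × ℂ) × (X → ℂ × ℂ) × (X → ℂ × ℂ) → (X → Sphere) × (X → Sphere) :=
    fun y => (fun x => ofHomogeneous (y.2.1 x), fun x => ofHomogeneous (y.2.2 x))
  have hne : ∀ {E : Type} [NormedAddCommGroup E] {z : E}, ‖z‖ = 1 → z ≠ 0 := fun h =>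
    norm_ne_zero_iff.1 (by rw [h]; exact one_ne_zero)
  have hF : ContinuousOn F (N ∩ C) := by
    rintro y ⟨⟨-, h1, h2⟩, -⟩
    refine ContinuousAt.continuousWithinAt ?_
    refine ContinuousAt.prodMk (continuousAt_pi.2 fun x => ?_) (continuousAt_pi.2 fun x => ?_)
    · refine ContinuousAt.comp (f := fun y : ((ℂ × ℂ) × ℂ × ℂ) × (X → ℂ × ℂ) × (X → ℂ × ℂ) =>
        y.2.1 x) (continuousAt_ofHomogeneous (hne ?_)) (by fun_prop)
      simpa using h1 x trivial
    · refine ContinuousAt.comp (f := fun y : ((ℂ × ℂ) × ℂ × ℂ) × (X → ℂ × ℂ) × (X → ℂ × ℂ) =>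
        y.2.2 x) (continuousAt_ofHomogeneous (hne ?_)) (by fun_prop)
      simpa using h2 x trivial
  convert ((hN.inter_right hC).image_of_continuousOn hF).isClosed using 1
  ext ⟨α, β⟩
  constructor
  · intro h
    choose z hz hz' using fun x => exists_ofHomogeneous_eq (α x)
    choose w hw hw' using fun x => exists_ofHomogeneous_eq (β x)
    obtain rfl : (fun x => ofHomogeneous (z x)) = α := funext hz'
    obtain rfl : (fun x => ofHomogeneous (w x)) = β := funext hw'
    obtain ⟨m, hm, hmx⟩ := (compat_iff (fun x => hne (hz x)) fun x => hne (hw x)).1 h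
    have hn : ‖m‖ ≠ 0 := norm_ne_zero_iff.2 hm
    refine ⟨(((‖m‖ : ℂ))⁻¹ • m, z, w), ⟨⟨?_, fun x _ => by simpa using hz x,
      fun x _ => by simpa using hw x⟩, fun x => ?_⟩, rfl⟩
    · rw [mem_sphere_zero_iff_norm, norm_smul, norm_inv, Complex.norm_real, norm_norm,
        inv_mul_cancel₀ hn]
    · have := hmx x
      simp only [Prod.smul_fst, Prod.smul_snd, smul_eq_mul]
      linear_combination ((‖m‖ : ℂ))⁻¹ * this
  · rintro ⟨⟨m, z, w⟩, ⟨⟨h1, h2, h3⟩, h4⟩, h5⟩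
    obtain ⟨rfl, rfl⟩ := Prod.ext_iff.1 h5
    refine (compat_iff (fun x => hne (by simpa using h2 x trivial))
      fun x => hne (by simpa using h3 x trivial)).2 ⟨m, hne (by simpa using h1), h4⟩

/-! ### Systems of normalized markings -/

section Triples

variable {X : Type*}

theorem injective_of_three {Y : Type*} {p : Fin 3 → Y} (h01 : p 0 ≠ p 1) (h02 : p 0 ≠ p 2)
    (h12 : p 1 ≠ p 2) : Function.Injective p := by
  intro j k
  fin_cases j <;> fin_cases k <;>
    simp [h01, h02, h12, h01.symm, h02.symm, h12.symm]

theorem exists_triple {a b c : X} (hab : a ≠ b) (hac : a ≠ c) (hbc : b ≠ c) :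
    ∃ t : Fin 3 ↪ X, t 0 = a ∧ t 1 = b ∧ t 2 = c :=
  ⟨⟨![a, b, c], injective_of_three hab hac hbc⟩, rfl, rfl, rfl⟩

theorem nonempty_triple [Finite X] (hX : 3 ≤ Nat.card X) : Nonempty (Fin 3 ↪ X) := by
  have := Fintype.ofFinite X
  refine Function.Embedding.nonempty_of_card_le ?_
  rwa [Fintype.card_fin, ← Nat.card_eq_fintype_card]

theorem exists_ne_and_ne [Finite X] (hX : 3 ≤ Nat.card X) (x y : X) : ∃ z, z ≠ x ∧ z ≠ y := by
  by_contra! hcon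
  have hsub : (Set.univ : Set X) ⊆ {x, y} := fun z _ => or_iff_not_imp_left.2 (hcon z)
  have h1 := Set.ncard_le_ncard hsub
  rw [Set.ncard_univ] at h1
  have h2 := Set.ncard_insert_le x {y}
  rw [Set.ncard_singleton] at h2
  omega

/-- Two compatible markings that both separate a triple differ by a Moebius transformation. -/
theorem Compat.exists_smul {α β : X → Sphere} (h : Compat α β) {t : Fin 3 → X}
    (hα : Function.Injective (α ∘ t)) (hβ : Function.Injective (β ∘ t)) :
    ∃ g : GL (Fin 2) ℂ, ∀ x, β x = g • α x := by
  refine h.resolve_right ?_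
  rintro ⟨a, b, hab⟩
  -- By injectivity each of the two alternatives holds for at most one index, so together they
  -- cannot cover three.
  have h2 : ∀ j k, j ≠ k → α (t j) = a → α (t k) = a → False :=
    fun j k hjk hj hk => hjk (hα (hj.trans hk.symm))
  have h3 : ∀ j k, j ≠ k → β (t j) = b → β (t k) = b → False :=
    fun j k hjk hj hk => hjk (hβ (hj.trans hk.symm))
  have d01 : (0 : Fin 3) ≠ 1 := by decide
  have d02 : (0 : Fin 3) ≠ 2 := by decide
  have d12 : (1 : Fin 3) ≠ 2 := by decide
  rcases hab (t 0) with h0 | h0 <;> rcases hab (t 1) with h1 | h1 <;>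
    rcases hab (t 2) with h2' | h2' <;>
    first
      | exact h2 _ _ d01 h0 h1
      | exact h2 _ _ d02 h0 h2'
      | exact h2 _ _ d12 h1 h2'
      | exact h3 _ _ d01 h0 h1
      | exact h3 _ _ d02 h0 h2'
      | exact h3 _ _ d12 h1 h2'

/-- The marking `α` sends the triple `t` to `0`, `1`, `∞`. -/
structure Normalized (α : X → Sphere) (t : Fin 3 ↪ X) : Prop where
  zero : α (t 0) = ((0 : ℂ) : Sphere)
  one : α (t 1) = ((1 : ℂ) : Sphere)
  infty : α (t 2) = OnePoint.infty

theorem Normalized.injective {α : X → Sphere} {t : Fin 3 ↪ X} (h : Normalized α t) :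
    Function.Injective (α ∘ t) := by
  apply injective_of_three <;> simp [h.zero, h.one, h.infty]

/-- The Moebius transformation `g` fixes 0, 1 and ∞. This turns every comparison of markings up to
Moebius into an equality. -/
theorem Normalized.eq_of_smul {α β : X → Sphere} {t : Fin 3 ↪ X} (hα : Normalized α t)
    (hβ : Normalized β t) {g : GL (Fin 2) ℂ} (hg : ∀ x, β x = g • α x) : β = α := by
  funext x
  rw [hg]
  apply moebius_unique
  · rw [← hα.zero, ← hg, hβ.zero, hα.zero]
  · rw [← hα.one, ← hg, hβ.one, hα.one]
  · rw [← hα.infty, ← hg, hβ.infty, hα.infty]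

end Triples

/-! ### Families of cross-ratios as systems of normalized markings -/

section Extend

variable {X : Type u}

theorem Quad.ext_of {q q' : Quad X} (h : q.triple = q'.triple) (h3 : q 3 = q' 3) : q = q' := by
  have e : ∀ k : Fin 3, q k.castSucc = q' k.castSucc := fun k => DFunLike.congr_fun h k
  ext k
  refine Fin.lastCases h3 e k

theorem Quad.exists_eq {t : Fin 3 ↪ X} {x : X} (h : ∀ k, t k ≠ x) :
    ∃ q : Quad X, q.triple = t ∧ q 3 = x := by
  refine ⟨⟨Fin.snoc t x, ?_⟩, ?_, ?_⟩
  · rw [Fin.snoc_injective_iff]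
    exact ⟨t.injective, by rintro ⟨k, hk⟩; exact h k hk⟩
  · ext k
    exact Fin.snoc_castSucc (α := fun _ => X) x t k
  · exact Fin.snoc_last (α := fun _ => X) x t

theorem Quad.triple_ne (q : Quad X) (k : Fin 3) : q.triple k ≠ q 3 := by
  intro h
  have : k.castSucc = Fin.last 3 := q.injective h
  exact (Fin.castSucc_lt_last k).ne this

open Classical in
/-- The marking with value `f (t, x)` at `x`, that sends `t` to `0`, `1`, `∞`. -/
noncomputable def extend (f : Quad X → Sphere) (t : Fin 3 ↪ X) (x : X) : Sphere :=
  if h : ∃ q : Quad X, q.triple = t ∧ q 3 = x then f h.choose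
  else if x = t 0 then ((0 : ℂ) : Sphere)
  else if x = t 1 then ((1 : ℂ) : Sphere)
  else OnePoint.infty

theorem extend_quad (f : Quad X → Sphere) (q : Quad X) : extend f q.triple (q 3) = f q := by
  have h : ∃ q' : Quad X, q'.triple = q.triple ∧ q' 3 = q 3 := ⟨q, rfl, rfl⟩
  rw [extend, dif_pos h]
  exact congrArg f (Quad.ext_of h.choose_spec.1 h.choose_spec.2)

theorem normalized_extend (f : Quad X → Sphere) (t : Fin 3 ↪ X) : Normalized (extend f t) t := by
  have h : ∀ k, ¬ ∃ q : Quad X, q.triple = t ∧ q 3 = t k := by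
    rintro k ⟨q, rfl, h⟩
    exact q.triple_ne k h.symm
  have h10 : t 1 ≠ t 0 := t.injective.ne (by decide)
  have h20 : t 2 ≠ t 0 := t.injective.ne (by decide)
  have h21 : t 2 ≠ t 1 := t.injective.ne (by decide)
  constructor <;> rw [extend, dif_neg (h _)]
  · simp
  · simp [h10]
  · simp [h20, h21]

/-- A normalized marking is prescribed on its own triple, and every other point completes the triple
to a quadruple. -/
theorem extend_eq {f : Quad X → Sphere} {α : (Fin 3 ↪ X) → X → Sphere}
    (hα : ∀ t, Normalized (α t) t) (hf : ∀ q : Quad X, f q = α q.triple (q 3)) : extend f = α := by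
  funext t x
  by_cases h : ∀ k, t k ≠ x
  · obtain ⟨q, rfl, rfl⟩ := Quad.exists_eq h
    rw [extend_quad, hf]
  · push Not at h
    obtain ⟨k, rfl⟩ := h
    have h1 := normalized_extend f t
    have h2 := hα t
    match k with
    | 0 => rw [h1.zero, h2.zero]
    | 1 => rw [h1.one, h2.one]
    | 2 => rw [h1.infty, h2.infty]

theorem continuous_extend (t : Fin 3 ↪ X) : Continuous fun f : Quad X → Sphere => extend f t := by
  refine continuous_pi fun x => ?_
  simp only [extend]
  split_ifs
  · exact continuous_apply _
  all_goals exact continuous_const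

variable (X) in
/-- The families of cross-ratios whose markings are pairwise compatible. -/
def compatibleFamilies : Set (Quad X → Sphere) :=
  {f | ∀ t t', Compat (extend f t) (extend f t')}

variable (X) in
theorem isClosed_compatibleFamilies : IsClosed (compatibleFamilies X) := by
  simp only [compatibleFamilies, Set.ofPred_forall]
  exact isClosed_iInter fun t => isClosed_iInter fun t' =>
    (isClosed_setOf_compat X).preimage ((continuous_extend t).prodMk (continuous_extend t'))

theorem exists_extend_markedSphereCrossRatios (i : X ↪ Sphere) (t : Fin 3 ↪ X) :
    ∃ g : GL (Fin 2) ℂ, ∀ x, extend (markedSphereCrossRatios i) t x = g • i x := by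
  let α : (Fin 3 ↪ X) → X → Sphere := fun t x =>
    ProjectiveSphere.standard.chart (fun k => i (t k)) (i.injective.comp t.injective) (i x)
  have hα : ∀ t, Normalized (α t) t := fun t =>
    have h := ProjectiveSphere.standard.chart_spec (fun k => i (t k))
      (i.injective.comp t.injective)
    ⟨h.2.1, h.2.2.1, h.2.2.2⟩
  rw [extend_eq (f := markedSphereCrossRatios i) hα fun q => rfl]
  obtain ⟨g, hg⟩ := (ProjectiveSphere.standard.chart_spec (fun k => i (t k))
    (i.injective.comp t.injective)).1
  refine ⟨g, fun x => ?_⟩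
  simp only [α]
  rw [← hg]
  rfl

variable (X) in
theorem range_markedSphereCrossRatios_subset :
    Set.range (markedSphereCrossRatios (X := X)) ⊆ compatibleFamilies X := by
  rintro _ ⟨i, rfl⟩ t t'
  obtain ⟨g, hg⟩ := exists_extend_markedSphereCrossRatios i t
  obtain ⟨g', hg'⟩ := exists_extend_markedSphereCrossRatios i t'
  exact Or.inl ⟨g' * g⁻¹, fun x => by rw [hg, hg', mul_smul, inv_smul_smul]⟩

end Extend

/-! ### Degeneration of marked spheres -/

section Degeneration

/-- The coordinate of a point of the Riemann sphere, with value `0` at `∞`. -/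
noncomputable def finiteCoord (p : Sphere) : ℂ := p.elim 0 id

@[simp] theorem finiteCoord_coe (z : ℂ) : finiteCoord (z : Sphere) = z := rfl

@[simp] theorem finiteCoord_infty : finiteCoord OnePoint.infty = 0 := rfl

theorem coe_finiteCoord {p : Sphere} (h : p ≠ OnePoint.infty) : (finiteCoord p : Sphere) = p := by
  induction p using OnePoint.rec with
  | infty => exact absurd rfl h
  | coe z => rfl

variable {X : Type*} {V : Type*}

/-- The depth of the marking `α`: the number of marked points at `∞`. -/
noncomputable def depth (α : X → Sphere) : ℕ := {x | α x = OnePoint.infty}.ncard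

/-- The marking of `ℂ` that glues the finite parts of the markings `β v`, each scaled
by `ε ^ depth (β v)`. -/
noncomputable def glue [Fintype V] (β : V → X → Sphere) (ε : ℂ) (x : X) : ℂ :=
  ∑ v, ε ^ depth (β v) * finiteCoord (β v x)

open Classical in
/-- The marking `glue β ε` with the root moved to `∞`. -/
noncomputable def glueSphere [Fintype V] (β : V → X → Sphere) (r : X) (ε : ℂ) (x : X) : Sphere :=
  if x = r then OnePoint.infty else (glue β ε x : Sphere)

/-- A family of markings, with `r` at `∞`, that comes from a rooted tree of spheres: two different
ones are constant off one fibre, each has at least three values, and any two points other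
than `r` are separated from each other and from `r` by one of the markings. -/
structure RootedFamily (β : V → X → Sphere) (r : X) : Prop where
  root : ∀ v, β v r = OnePoint.infty
  compat : ∀ u v, u ≠ v → ∃ a b, ∀ x, β u x = a ∨ β v x = b
  exists_ne : ∀ v a b, ∃ x, β v x ≠ a ∧ β v x ≠ b
  separates : ∀ x y, x ≠ y → x ≠ r → y ≠ r →
    ∃ v, β v x ≠ OnePoint.infty ∧ β v y ≠ OnePoint.infty ∧ β v x ≠ β v y

namespace RootedFamily

variable [Finite X] {β : V → X → Sphere} {r : X}

/-- A point at ∞ for `v` is not in the fibre over `b`, hence is at ∞ for `u`. The inclusion is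
strict, since `v` takes a third value, and a point where it does so is at ∞ for `u` only. -/
theorem depth_lt {u v : V} (h : RootedFamily β r) {b : Sphere} (hb : b ≠ OnePoint.infty)
    (hab : ∀ x, β u x = OnePoint.infty ∨ β v x = b) : depth (β v) < depth (β u) := by
  obtain ⟨x, hx1, hx2⟩ := h.exists_ne v OnePoint.infty b
  refine Set.ncard_lt_ncard ⟨fun y hy => ?_, fun hs => ?_⟩ (Set.toFinite _)
  · exact (hab y).resolve_right fun h => hb (h.symm.trans hy)
  · exact hx1 (hs ((hab x).resolve_right hx2))

/-- The comparison behind the powers of `ε`: among points that `v` sees at finite distance, another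
vertex either makes no distinction or is deeper, and so contributes at a smaller scale. The root
decides which case occurs, as it is at ∞ for both. -/
theorem eq_or_depth_lt (h : RootedFamily β r) {u v : V} (huv : u ≠ v) {x y : X}
    (hx : β v x ≠ OnePoint.infty) (hy : β v y ≠ OnePoint.infty) :
    β u x = β u y ∨ depth (β v) < depth (β u) := by
  obtain ⟨a, b, hab⟩ := h.compat u v huv
  by_cases hb : b = OnePoint.infty
  · subst hb
    exact Or.inl (((hab x).resolve_right hx).trans ((hab y).resolve_right hy).symm)
  · right
    have ha : a = OnePoint.infty := by
      rcases hab r with h' | h'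
      · rw [← h', h.root]
      · exact absurd (h'.symm.trans (h.root v)) hb
    subst ha
    exact h.depth_lt hb hab

/-- A vertex that sees both points at finite distance, one of which has escaped to ∞ for `v`, is
closer to the root than `v`. Again the root shows which of the two special values is ∞. -/
theorem depth_lt_of_infty (h : RootedFamily β r) {u v : V} {x y : X}
    (hux : β u x ≠ OnePoint.infty) (huy : β u y ≠ OnePoint.infty)
    (hx : β v x = OnePoint.infty) (hy : β v y ≠ OnePoint.infty) :
    depth (β u) < depth (β v) := by
  have huv : v ≠ u := by rintro rfl; exact hux hx
  obtain ⟨a, b, hab⟩ := h.compat v u huv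
  by_cases ha : a = OnePoint.infty
  · subst ha
    refine h.depth_lt ?_ hab
    rintro rfl
    exact huy ((hab y).resolve_left hy)
  · exfalso
    have hb : b = OnePoint.infty := by
      rcases hab r with h' | h'
      · exact absurd (h'.symm.trans (h.root v)) ha
      · rw [← h', h.root]
    subst hb
    rcases hab x with h' | h'
    · exact ha (h'.symm.trans hx)
    · exact hux h'

variable [Fintype V]

/-- In the difference quotient the term of `v` itself is the limit. By `eq_or_depth_lt` every other
term cancels or carries a positive power of `ε`. -/
theorem tendsto_glue_sub (h : RootedFamily β r) {v : V} {x y : X}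
    (hx : β v x ≠ OnePoint.infty) (hy : β v y ≠ OnePoint.infty) :
    Tendsto (fun ε => (glue β ε x - glue β ε y) / ε ^ depth (β v)) (𝓝[≠] 0)
      (𝓝 (finiteCoord (β v x) - finiteCoord (β v y))) := by
  classical
  have e : ∀ ε, (glue β ε x - glue β ε y) / ε ^ depth (β v) =
      ∑ u, ε ^ depth (β u) / ε ^ depth (β v) * (finiteCoord (β u x) - finiteCoord (β u y)) := by
    intro ε
    rw [glue, glue, ← Finset.sum_sub_distrib, Finset.sum_div]
    exact Finset.sum_congr rfl fun u _ => by ring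
  simp only [e]
  have e2 : finiteCoord (β v x) - finiteCoord (β v y) =
      ∑ u, if u = v then finiteCoord (β u x) - finiteCoord (β u y) else 0 := by
    simp
  rw [e2]
  refine tendsto_finsetSum _ fun u _ => ?_
  by_cases huv : u = v
  · subst huv
    rw [if_pos rfl]
    refine tendsto_const_nhds.congr' ?_
    filter_upwards [self_mem_nhdsWithin] with ε hε
    rw [div_self (pow_ne_zero _ hε), one_mul]
  · rw [if_neg huv]
    rcases h.eq_or_depth_lt huv hx hy with h1 | h1
    · simp [h1]
    · have h2 : Tendsto (fun ε : ℂ => ε ^ (depth (β u) - depth (β v)) *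
          (finiteCoord (β u x) - finiteCoord (β u y))) (𝓝[≠] 0) (𝓝 0) := by
        have h3 : Continuous fun ε : ℂ => ε ^ (depth (β u) - depth (β v)) *
          (finiteCoord (β u x) - finiteCoord (β u y)) := by fun_prop
        have h4 := h3.tendsto 0
        rw [zero_pow (by omega), zero_mul] at h4
        exact h4.mono_left nhdsWithin_le_nhds
      refine h2.congr' ?_
      filter_upwards [self_mem_nhdsWithin] with ε hε
      rw [pow_sub₀ _ hε h1.le, div_eq_mul_inv]

/-- Some vertex `u` separates the two points at finite distance and has smaller depth. The
difference is therefore of exact order `ε ^ depth (β u)`, which dominates the divisor. -/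
theorem tendsto_glue_sub_infty (h : RootedFamily β r) {v : V} {x y : X} (hxr : x ≠ r)
    (hx : β v x = OnePoint.infty) (hy : β v y ≠ OnePoint.infty) :
    Tendsto (fun ε => (glue β ε x - glue β ε y) / ε ^ depth (β v)) (𝓝[≠] 0)
      (Bornology.cobounded ℂ) := by
  have hyr : y ≠ r := by rintro rfl; exact hy (h.root v)
  have hxy : x ≠ y := by rintro rfl; exact hy hx
  obtain ⟨u, h1, h2, h3⟩ := h.separates x y hxy hxr hyr
  have hlt := h.depth_lt_of_infty h1 h2 hx hy
  have ht := h.tendsto_glue_sub h1 h2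
  have hne : finiteCoord (β u x) - finiteCoord (β u y) ≠ 0 := by
    intro h0
    apply h3
    rw [← coe_finiteCoord h1, ← coe_finiteCoord h2, sub_eq_zero.1 h0]
  have hp : Tendsto (fun ε : ℂ => ε ^ (depth (β v) - depth (β u))) (𝓝[≠] 0) (𝓝[≠] 0) := by
    refine tendsto_nhdsWithin_iff.2 ⟨?_, ?_⟩
    · have h4 := (continuous_pow (M := ℂ) (depth (β v) - depth (β u))).tendsto 0
      rw [zero_pow (by omega)] at h4
      exact h4.mono_left nhdsWithin_le_nhds
    · filter_upwards [self_mem_nhdsWithin] with ε hε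
      exact pow_ne_zero _ hε
  have hi := (Filter.tendsto_inv₀_nhdsNE_zero (α := ℂ)).comp hp
  rw [← tendsto_norm_atTop_iff_cobounded] at hi ⊢
  refine (Tendsto.pos_mul_atTop (norm_pos_iff.2 hne) ht.norm hi).congr' ?_
  filter_upwards [self_mem_nhdsWithin] with ε hε
  have hε' : ε ≠ 0 := hε
  rw [Function.comp_apply, ← norm_mul]
  congr 1
  obtain ⟨k, hk⟩ := Nat.exists_eq_add_of_le hlt.le
  rw [hk, Nat.add_sub_cancel_left, pow_add]
  field_simp

theorem eventually_injOn_glue (h : RootedFamily β r) :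
    ∀ᶠ ε in 𝓝[≠] (0 : ℂ), ∀ x y, x ≠ y → x ≠ r → y ≠ r → glue β ε x ≠ glue β ε y := by
  refine eventually_all.2 fun x => eventually_all.2 fun y => ?_
  by_cases hxy : x ≠ y ∧ x ≠ r ∧ y ≠ r
  · obtain ⟨u, h1, h2, h3⟩ := h.separates x y hxy.1 hxy.2.1 hxy.2.2
    have hne : finiteCoord (β u x) - finiteCoord (β u y) ≠ 0 := by
      intro h0
      apply h3
      rw [← coe_finiteCoord h1, ← coe_finiteCoord h2, sub_eq_zero.1 h0]
    filter_upwards [(h.tendsto_glue_sub h1 h2).eventually_ne hne] with ε hε _ _ _ he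
    apply hε
    rw [he, sub_self, zero_div]
  · exact Eventually.of_forall fun ε h1 h2 h3 => absurd ⟨h1, h2, h3⟩ hxy

theorem eventually_injective (h : RootedFamily β r) :
    ∀ᶠ ε in 𝓝[≠] (0 : ℂ), Function.Injective (glueSphere β r ε) := by
  filter_upwards [h.eventually_injOn_glue] with ε hε x y hxy
  by_contra hne
  by_cases hx : x = r
  · have hy : y ≠ r := fun hy => hne (hx.trans hy.symm)
    simp [glueSphere, hx, hy] at hxy
  · by_cases hy : y = r
    · simp [glueSphere, hx, hy] at hxy
    · rw [glueSphere, glueSphere, if_neg hx, if_neg hy, OnePoint.coe_eq_coe] at hxy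
      exact hε x y hne hx hy hxy

/-- Each marking `β v` is a limit of rescaled glued markings. -/
theorem exists_rescaling (h : RootedFamily β r) (v : V) :
    ∃ g : ℂ → GL (Fin 2) ℂ,
      Tendsto (fun ε x => g ε • glueSphere β r ε x) (𝓝[≠] 0) (𝓝 (β v)) := by
  obtain ⟨y, hy, -⟩ := h.exists_ne v OnePoint.infty OnePoint.infty
  have hg : ∀ ε : ℂ, ∃ g : GL (Fin 2) ℂ, ε ≠ 0 → g • (OnePoint.infty : Sphere) = OnePoint.infty ∧
      ∀ z : ℂ, g • (z : Sphere) = (((z - glue β ε y) / ε ^ depth (β v) +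
        finiteCoord (β v y) : ℂ) : Sphere) := by
    intro ε
    by_cases hε : ε = 0
    · exact ⟨1, fun h => absurd hε h⟩
    have hp : ε ^ depth (β v) ≠ 0 := pow_ne_zero _ hε
    -- The affine map that magnifies by `ε ^ (-depth (β v))` about the point `y` and places `y` at
    -- its coordinate in `β v`.
    obtain ⟨g, g1, g2, g3, g4⟩ := exists_GL_of_det_ne_zero 1
      (- glue β ε y + finiteCoord (β v y) * ε ^ depth (β v)) 0 (ε ^ depth (β v)) (by simpa using hp)
    refine ⟨g, fun _ => ⟨OnePoint.smul_infty_eq_self_iff.2 g3, fun z => ?_⟩⟩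
    rw [OnePoint.smul_some_eq_ite, g1, g2, g3, g4, if_neg (by simpa using hp)]
    congr 1
    field_simp
    ring
  choose g hg using hg
  refine ⟨g, tendsto_pi_nhds.2 fun x => ?_⟩
  by_cases hxr : x = r
  · subst hxr
    rw [h.root]
    refine tendsto_const_nhds.congr' ?_
    filter_upwards [self_mem_nhdsWithin] with ε hε
    rw [glueSphere, if_pos rfl, (hg ε hε).1]
  · have e : (fun ε => (((glue β ε x - glue β ε y) / ε ^ depth (β v) +
        finiteCoord (β v y) : ℂ) : Sphere)) =ᶠ[𝓝[≠] 0] fun ε => g ε • glueSphere β r ε x := by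
      filter_upwards [self_mem_nhdsWithin] with ε hε
      rw [glueSphere, if_neg hxr, (hg ε hε).2]
    refine Tendsto.congr' e ?_
    by_cases hx : β v x = OnePoint.infty
    · rw [hx]
      have h1 := h.tendsto_glue_sub_infty hxr hx hy
      have h3 : Tendsto (fun ε => (glue β ε x - glue β ε y) / ε ^ depth (β v) +
          finiteCoord (β v y)) (𝓝[≠] 0) (cocompact ℂ) := by
        rw [← Metric.cobounded_eq_cocompact]
        exact (tendsto_add_const_cobounded _).comp h1
      have h2 := (OnePoint.tendsto_coe_infty (X := ℂ))
      rw [Filter.coclosedCompact_eq_cocompact] at h2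
      exact h2.comp h3
    · have h1 := (h.tendsto_glue_sub hx hy).add_const (finiteCoord (β v y))
      rw [sub_add_cancel] at h1
      have h2 := ((OnePoint.continuous_coe (X := ℂ)).tendsto _).comp h1
      rw [coe_finiteCoord hx] at h2
      exact h2

end RootedFamily

end Degeneration

/-! ### Compatible families are limits of marked spheres -/

section Closure

variable {X : Type u}

/-- If the marking of the triple `t` separates the triple `t'`, then the markings of `t` and `t'`
differ by a Moebius transformation. -/
theorem exists_smul_of_separates {f : Quad X → Sphere} (hf : f ∈ compatibleFamilies X)
    {t t' : Fin 3 ↪ X} (h : Function.Injective (extend f t ∘ t')) :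
    ∃ g : GL (Fin 2) ℂ, ∀ x, extend f t' x = g • extend f t x :=
  (hf t t').exists_smul h (normalized_extend f t').injective

/-- Each marking differs by a Moebius transformation from one that sends `r` to `∞`. -/
theorem exists_triple_root {f : Quad X → Sphere} (hf : f ∈ compatibleFamilies X) (r : X)
    (t : Fin 3 ↪ X) : ∃ t' : Fin 3 ↪ X, t' 2 = r ∧
      ∃ g : GL (Fin 2) ℂ, ∀ x, extend f t' x = g • extend f t x := by
  have hinj := (normalized_extend f t).injective
  have hne : ∀ j k, j ≠ k → extend f t (t j) ≠ extend f t (t k) := fun j k hjk h => hjk (hinj h)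
  -- The root shares its value with at most one point of the triple; two others, together with the
  -- root, are still separated.
  obtain ⟨j, k, h1, h2, h3⟩ : ∃ j k, extend f t (t j) ≠ extend f t (t k) ∧
      extend f t (t j) ≠ extend f t r ∧ extend f t (t k) ≠ extend f t r := by
    by_cases h0 : extend f t (t 0) = extend f t r
    · exact ⟨1, 2, hne _ _ (by decide), h0 ▸ hne _ _ (by decide), h0 ▸ hne _ _ (by decide)⟩
    · by_cases h1 : extend f t (t 1) = extend f t r
      · exact ⟨0, 2, hne _ _ (by decide), h0, h1 ▸ hne _ _ (by decide)⟩
      · exact ⟨0, 1, hne _ _ (by decide), h0, h1⟩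
  obtain ⟨t', e0, e1, e2⟩ := exists_triple (ne_of_apply_ne _ h1) (ne_of_apply_ne _ h2)
    (ne_of_apply_ne _ h3)
  refine ⟨t', e2, exists_smul_of_separates hf (injective_of_three ?_ ?_ ?_)⟩ <;>
    simp only [Function.comp_apply, e0, e1, e2] <;> assumption

/-- Markings that differ by a Moebius transformation are equivalent. -/
def markingSetoid (f : Quad X → Sphere) (P : (Fin 3 ↪ X) → Prop) :
    Setoid {t : Fin 3 ↪ X // P t} where
  r t t' := ∃ g : GL (Fin 2) ℂ, ∀ x, extend f t'.1 x = g • extend f t.1 x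
  iseqv :=
    { refl := fun t => ⟨1, fun x => by simp⟩
      symm := fun ⟨g, hg⟩ => ⟨g⁻¹, fun x => by rw [hg, inv_smul_smul]⟩
      trans := fun ⟨g, hg⟩ ⟨g', hg'⟩ => ⟨g' * g, fun x => by rw [hg', hg, mul_smul]⟩ }

/-- A marking for each class of equivalent markings. -/
noncomputable def classMarking (f : Quad X → Sphere) (P : (Fin 3 ↪ X) → Prop)
    (v : Quotient (markingSetoid f P)) : X → Sphere :=
  extend f v.out.1

theorem classMarking_mk (f : Quad X → Sphere) (P : (Fin 3 ↪ X) → Prop) {t : Fin 3 ↪ X}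
    (ht : P t) : ∃ g : GL (Fin 2) ℂ, ∀ x,
      classMarking f P (Quotient.mk _ ⟨t, ht⟩) x = g • extend f t x :=
  (markingSetoid f P).symm (Quotient.mk_out (s := markingSetoid f P) ⟨t, ht⟩)

theorem classMarking_exists_ne (f : Quad X → Sphere) (P : (Fin 3 ↪ X) → Prop)
    (v : Quotient (markingSetoid f P)) (a b : Sphere) :
    ∃ x, classMarking f P v x ≠ a ∧ classMarking f P v x ≠ b := by
  have hinj := (normalized_extend f v.out.1).injective
  by_contra! h
  have h' : ∀ k, classMarking f P v (v.out.1 k) = a ∨ classMarking f P v (v.out.1 k) = b :=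
    fun k => or_iff_not_imp_left.2 (h _)
  have hne : ∀ j k c, j ≠ k → classMarking f P v (v.out.1 j) = c →
      classMarking f P v (v.out.1 k) = c → False :=
    fun j k c hjk h1 h2 => hjk (hinj (h1.trans h2.symm))
  rcases h' 0 with h0 | h0 <;> rcases h' 1 with h1 | h1 <;> rcases h' 2 with h2 | h2 <;>
    first
      | exact hne 0 1 _ (by decide) h0 h1
      | exact hne 0 2 _ (by decide) h0 h2
      | exact hne 1 2 _ (by decide) h1 h2

theorem classMarking_compat {f : Quad X → Sphere} (hf : f ∈ compatibleFamilies X)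
    (P : (Fin 3 ↪ X) → Prop) {u v : Quotient (markingSetoid f P)} (huv : u ≠ v) :
    ∃ a b, ∀ x, classMarking f P u x = a ∨ classMarking f P v x = b := by
  refine (hf u.out.1 v.out.1).resolve_left fun hg => huv ?_
  rw [← Quotient.out_eq u, ← Quotient.out_eq v]
  exact Quotient.sound hg

theorem classMarking_root (f : Quad X → Sphere) (r : X)
    (v : Quotient (markingSetoid f fun t => t 2 = r)) :
    classMarking f (fun t => t 2 = r) v r = OnePoint.infty := by
  have := (normalized_extend f v.out.1).infty
  rwa [v.out.2] at this

/-- Two points `x`, `y` other than the root are separated, away from ∞, by the class of the triple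
`(x, y, r)`. -/
theorem rootedFamily_classMarking {f : Quad X → Sphere} (hf : f ∈ compatibleFamilies X) (r : X) :
    RootedFamily (classMarking f fun t => t 2 = r) r where
  root := classMarking_root f r
  compat u v := classMarking_compat hf _
  exists_ne := classMarking_exists_ne f _
  separates x y hxy hx hy := by
    obtain ⟨t, rfl, rfl, rfl⟩ := exists_triple hxy hx hy
    obtain ⟨g, hg⟩ := classMarking_mk f (fun t' => t' 2 = t 2) (t := t) rfl
    have hne : ∀ j k, j ≠ k → classMarking f (fun t' => t' 2 = t 2) (Quotient.mk _ ⟨t, rfl⟩) (t j) ≠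
        classMarking f (fun t' => t' 2 = t 2) (Quotient.mk _ ⟨t, rfl⟩) (t k) := by
      intro j k hjk
      rw [hg, hg, (MulAction.injective g).ne_iff]
      exact (normalized_extend f t).injective.ne hjk
    refine ⟨Quotient.mk _ ⟨t, rfl⟩, ?_, ?_, hne 0 1 (by decide)⟩
    · rw [← classMarking_root f (t 2) (Quotient.mk _ ⟨t, rfl⟩)]
      exact hne 0 2 (by decide)
    · rw [← classMarking_root f (t 2) (Quotient.mk _ ⟨t, rfl⟩)]
      exact hne 1 2 (by decide)

/-- The cross-ratios of the glued spheres need not be shown to converge: a limit along an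
ultrafilter exists by compactness, and compatibility with the rescaled limits forces it to be `f`.
-/
theorem compatibleFamilies_subset_closure [Finite X] [Nonempty X] :
    compatibleFamilies X ⊆ closure (Set.range (markedSphereCrossRatios (X := X))) := by
  classical
  intro f hf
  obtain ⟨r⟩ := ‹Nonempty X›
  let V := Quotient (markingSetoid f fun t => t 2 = r)
  have : Finite (Fin 3 ↪ X) := Finite.of_injective _ DFunLike.coe_injective
  have : Finite V := Quotient.finite _
  have : Fintype V := Fintype.ofFinite V
  let β : V → X → Sphere := classMarking f fun t => t 2 = r
  have h : RootedFamily β r := rootedFamily_classMarking hf r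
  let F : ℂ → Quad X → Sphere := fun ε =>
    -- The value for a non-injective gluing is irrelevant, as gluings are injective for small
    -- nonzero `ε`.
    if hε : Function.Injective (glueSphere β r ε) then
      markedSphereCrossRatios ⟨glueSphere β r ε, hε⟩ else fun _ => OnePoint.infty
  let U : Ultrafilter ℂ := Ultrafilter.of (𝓝[≠] (0 : ℂ))
  have hU : (U : Filter ℂ) ≤ 𝓝[≠] 0 := Ultrafilter.of_le _
  obtain ⟨f', -, hf'⟩ := isCompact_univ.ultrafilter_le_nhds (U.map F) (by simp)
  have hlim : Tendsto F U (𝓝 f') := hf'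
  have hF : ∀ᶠ ε in (U : Filter ℂ), ∃ i : X ↪ Sphere, (∀ x, i x = glueSphere β r ε x) ∧
      F ε = markedSphereCrossRatios i := by
    filter_upwards [hU h.eventually_injective] with ε hε
    exact ⟨⟨_, hε⟩, fun x => rfl, dif_pos hε⟩
  have hmem : f' ∈ closure (Set.range (markedSphereCrossRatios (X := X))) := by
    refine mem_closure_of_tendsto hlim ?_
    filter_upwards [hF] with ε hε
    obtain ⟨i, -, hi⟩ := hε
    exact ⟨i, hi.symm⟩
  suffices hext : ∀ t, extend f' t = extend f t by
    convert hmem using 1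
    funext q
    rw [← extend_quad f, ← extend_quad f', hext]
  intro t
  obtain ⟨v, g, hg⟩ : ∃ (v : V) (g : GL (Fin 2) ℂ), ∀ x, β v x = g • extend f t x := by
    obtain ⟨t', ht', g, hg⟩ := exists_triple_root hf r t
    obtain ⟨g', hg'⟩ := classMarking_mk f (fun t => t 2 = r) ht'
    exact ⟨Quotient.mk _ ⟨t', ht'⟩, g' * g, fun x => by rw [mul_smul, ← hg]; exact hg' x⟩
  obtain ⟨k, hk⟩ := h.exists_rescaling v
  -- Before the limit both markings are Moebius images of the same glued sphere, hence compatible,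
  -- and compatibility is closed. Since `β v` separates `t`, the limits still differ by a Moebius
  -- transformation.
  have hcompat : Compat (β v) (extend f' t) := by
    have h1 : Tendsto (fun ε => ((fun x => k ε • glueSphere β r ε x), extend (F ε) t)) U
        (𝓝 (β v, extend f' t)) :=
      (hk.mono_left hU).prodMk_nhds (((continuous_extend t).tendsto f').comp hlim)
    refine (isClosed_setOf_compat X).mem_of_tendsto h1 ?_
    filter_upwards [hF] with ε hε
    obtain ⟨i, hi1, hi2⟩ := hε
    obtain ⟨m, hm⟩ := exists_extend_markedSphereCrossRatios i t
    refine Or.inl ⟨m * (k ε)⁻¹, fun x => ?_⟩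
    simp only
    rw [hi2, hm, hi1, mul_smul, inv_smul_smul]
  have hinj : Function.Injective (β v ∘ t) := by
    intro j k hjk
    simp only [Function.comp_apply, hg] at hjk
    exact (normalized_extend f t).injective (MulAction.injective g hjk)
  obtain ⟨m, hm⟩ := hcompat.exists_smul hinj (normalized_extend f' t).injective
  exact (normalized_extend f t).eq_of_smul (normalized_extend f' t) (g := m * g)
    fun x => by rw [hm, hg, mul_smul]

end Closure

/-! ### The tree of a family of markings -/

/-- A family of maps on `X` that behaves like the markings of the internal vertices of a stable
tree. -/
structure TreeFamily {X ι S : Type*} (β : ι → X → S) : Prop where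
  compat : ∀ u v, u ≠ v → ∃ a b, ∀ x, β u x = a ∨ β v x = b
  exists_ne : ∀ v a b, ∃ x, β v x ≠ a ∧ β v x ≠ b
  separates : ∀ t : Fin 3 ↪ X, ∃ v, Function.Injective (β v ∘ t)

section TreeFamily

variable {X ι S : Type*} [Nonempty S] {β : ι → X → S}

/-- The value of `β v` on the side of a leaf or of another internal vertex. -/
noncomputable def direction (β : ι → X → S) (v : ι) : X ⊕ ι → S
  | Sum.inl x => β v x
  | Sum.inr u => Classical.epsilon fun a => ∃ b, ∀ x, β v x = a ∨ β u x = b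

/-- A leaf `x` is adjacent to `v` if it is alone in its fibre of `β v`; two internal vertices are
adjacent if no leaf lies between them. -/
def familyGraph (β : ι → X → S) : SimpleGraph (X ⊕ ι) where
  Adj
  | Sum.inl _, Sum.inl _ => False
  | Sum.inl x, Sum.inr v => ∀ y, β v y = β v x → y = x
  | Sum.inr v, Sum.inl x => ∀ y, β v y = β v x → y = x
  | Sum.inr u, Sum.inr v => u ≠ v ∧
      ∀ x, ¬ (β u x = direction β u (Sum.inr v) ∧ β v x = direction β v (Sum.inr u))
  symm := ⟨by
    rintro (x | u) (y | v) h
    · exact h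
    · exact h
    · exact h
    · exact ⟨h.1.symm, fun x hx => h.2 x hx.symm⟩⟩
  loopless := ⟨by
    rintro (x | u) h
    · exact h
    · exact h.1 rfl⟩

theorem familyGraph_adj_inr {u v : ι} :
    (familyGraph β).Adj (Sum.inr u) (Sum.inr v) ↔ u ≠ v ∧
      ∀ x, ¬ (β u x = direction β u (Sum.inr v) ∧ β v x = direction β v (Sum.inr u)) := Iff.rfl

namespace TreeFamily

omit [Nonempty S] in
-- A leaf where `β v` avoids both `b` and `b'` has both `a` and `a'` as its value under `β u`. Thus
-- the direction from one vertex to another is well defined.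
theorem value_unique (h : TreeFamily β) {u v : ι} {a b a' b' : S}
    (hab : ∀ x, β u x = a ∨ β v x = b) (hab' : ∀ x, β u x = a' ∨ β v x = b') : a = a' := by
  by_contra hne
  obtain ⟨x, hx, hx'⟩ := h.exists_ne u a a'
  have e := (hab x).resolve_left hx
  have e' := (hab' x).resolve_left hx'
  obtain ⟨y, hy, hy'⟩ := h.exists_ne v b b'
  exact hne (((hab y).resolve_right hy).symm.trans ((hab' y).resolve_right hy'))

theorem direction_or (h : TreeFamily β) {u v : ι} (huv : u ≠ v) (x : X) :
    β u x = direction β u (Sum.inr v) ∨ β v x = direction β v (Sum.inr u) := by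
  have h1 : ∃ b, ∀ x, β u x = direction β u (Sum.inr v) ∨ β v x = b :=
    Classical.epsilon_spec (h.compat u v huv)
  have h2 : ∃ b, ∀ x, β v x = direction β v (Sum.inr u) ∨ β u x = b :=
    Classical.epsilon_spec (h.compat v u huv.symm)
  obtain ⟨b, hb⟩ := h1
  obtain ⟨a, ha⟩ := h2
  rw [← h.value_unique (fun x => (hb x).symm) ha]
  exact hb x

theorem eq_right (h : TreeFamily β) {u v : ι} (huv : u ≠ v) {x : X}
    (hx : β u x ≠ direction β u (Sum.inr v)) : β v x = direction β v (Sum.inr u) :=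
  (h.direction_or huv x).resolve_left hx

/-- A leaf that `w` sees in neither the direction of `u` nor that of `v` represents `w` as seen from
both, which reduces the claim to leaves. -/
theorem direction_or_inr (h : TreeFamily β) {u v w : ι} (huv : u ≠ v) (hwu : w ≠ u) (hwv : w ≠ v) :
    direction β u (Sum.inr w) = direction β u (Sum.inr v) ∨
      direction β v (Sum.inr w) = direction β v (Sum.inr u) := by
  obtain ⟨x, hx, hx'⟩ := h.exists_ne w (direction β w (Sum.inr u)) (direction β w (Sum.inr v))
  rw [← h.eq_right hwu hx, ← h.eq_right hwv hx']
  exact h.direction_or huv x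

/-- The direction at `v` is constant along edges that avoid `v`. -/
theorem direction_eq_of_adj (h : TreeFamily β) {v : ι} {a b : X ⊕ ι} (hab : (familyGraph β).Adj a b)
    (ha : a ≠ Sum.inr v) (hb : b ≠ Sum.inr v) : direction β v a = direction β v b := by
  have key : ∀ (u : ι) (y : X), u ≠ v → (∀ z, β u z = β u y → z = y) →
      direction β v (Sum.inr u) = β v y := by
    intro u y hu hy
    by_contra hne
    obtain ⟨x, hx, hx'⟩ := h.exists_ne v (direction β v (Sum.inr u)) (β v y)
    have h1 := h.eq_right hu.symm hx
    have h2 := h.eq_right hu.symm (Ne.symm hne)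
    exact hx' (congrArg (β v) (hy x (h1.trans h2.symm)))
  rcases a with x | u <;> rcases b with y | w
  · exact hab.elim
  · exact (key w x (fun e => hb (congrArg _ e)) hab).symm
  · exact key u y (fun e => ha (congrArg _ e)) hab
  · by_contra hne
    have hu : u ≠ v := fun e => ha (congrArg _ e)
    have hw : w ≠ v := fun e => hb (congrArg _ e)
    obtain ⟨huw, hadj⟩ := familyGraph_adj_inr.1 hab
    -- If `v` saw the ends `u`, `w` in different directions, a leaf off both directions would lie
    -- between `u` and `w`, against their adjacency.
    obtain ⟨x, hx, hx'⟩ := h.exists_ne v (direction β v (Sum.inr u)) (direction β v (Sum.inr w))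
    refine hadj x ⟨?_, ?_⟩
    · rw [h.eq_right hu.symm hx,
        (h.direction_or_inr hu.symm hw huw.symm).resolve_left (Ne.symm hne)]
    · rw [h.eq_right hw.symm hx', (h.direction_or_inr hw.symm hu huw).resolve_left hne]

theorem direction_eq_of_walk (h : TreeFamily β) {v : ι} {a b : X ⊕ ι} (p : (familyGraph β).Walk a b)
    (hp : Sum.inr v ∉ p.support) : direction β v a = direction β v b := by
  induction p with
  | nil => rfl
  | cons hab p ih =>
    rw [SimpleGraph.Walk.support_cons, List.mem_cons, not_or] at hp
    refine (h.direction_eq_of_adj hab (Ne.symm hp.1) ?_).trans (ih hp.2)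
    rintro rfl
    exact hp.2 p.start_mem_support

/-- Different edges at `v` have different directions. -/
theorem eq_of_direction_eq (h : TreeFamily β) {v : ι} {a b : X ⊕ ι}
    (ha : (familyGraph β).Adj (Sum.inr v) a) (hb : (familyGraph β).Adj (Sum.inr v) b)
    (hab : direction β v a = direction β v b) : a = b := by
  have key : ∀ (u : ι) (y : X), v ≠ u → (∀ z, β v z = β v y → z = y) →
      direction β v (Sum.inr u) ≠ β v y := by
    intro u y hu hy he
    obtain ⟨k, hk, -⟩ := h.exists_ne u (direction β u (Sum.inr v)) (direction β u (Sum.inr v))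
    obtain ⟨k', hk', hkk'⟩ := h.exists_ne u (direction β u (Sum.inr v)) (β u k)
    have e := hy k ((h.eq_right hu.symm hk).trans he)
    have e' := hy k' ((h.eq_right hu.symm hk').trans he)
    exact hkk' (by rw [e, e'])
  rcases a with x | u <;> rcases b with y | w
  · exact congrArg _ (hb x hab)
  · exact absurd hab.symm (key w x hb.1 ha)
  · exact absurd hab (key u y ha.1 hb)
  · by_contra hne
    have huw : u ≠ w := fun e => hne (congrArg _ e)
    have hu : ∀ k, β v k = direction β v (Sum.inr u) → β u k ≠ direction β u (Sum.inr v) :=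
      fun k h1 h2 => ha.2 k ⟨h1, h2⟩
    have hw : ∀ k, β v k = direction β v (Sum.inr u) → β w k ≠ direction β w (Sum.inr v) :=
      fun k h1 h2 => hb.2 k ⟨h1.trans hab, h2⟩
    -- By adjacency, every leaf in the common direction lies beyond both `u` and `w`. A leaf `k`
    -- outside it shows that one of them sees the other in the direction of `v`; a leaf `z` beyond
    -- that other one is then in the common direction but not beyond the first.
    obtain ⟨k, hk, -⟩ := h.exists_ne v (direction β v (Sum.inr u)) (direction β v (Sum.inr u))
    have hk1 := h.eq_right ha.1 hk
    have hk2 := h.eq_right hb.1 (fun e => hk (e.trans hab.symm))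
    rcases h.direction_or huw k with e | e
    · obtain ⟨z, hz1, hz2⟩ := h.exists_ne w (direction β w (Sum.inr u)) (direction β w (Sum.inr v))
      have hzv : β v z = direction β v (Sum.inr u) :=
        (h.eq_right hb.1.symm hz2).trans hab.symm
      apply hu z hzv
      rw [h.eq_right huw.symm hz1, ← e, hk1]
    · obtain ⟨z, hz1, hz2⟩ := h.exists_ne u (direction β u (Sum.inr w)) (direction β u (Sum.inr v))
      have hzv : β v z = direction β v (Sum.inr u) := h.eq_right ha.1.symm hz2
      apply hw z hzv
      rw [h.eq_right huw hz1, ← e, hk2]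

variable [Finite X] [Finite ι]

/-- Each value of `β v` is the direction of an edge at `v`. -/
theorem exists_adj (h : TreeFamily β) (v : ι) (x : X) :
    ∃ w, (familyGraph β).Adj (Sum.inr v) w ∧ direction β v w = β v x := by
  by_cases hx : ∀ y, β v y = β v x → y = x
  · exact ⟨Sum.inl x, hx, rfl⟩
  push Not at hx
  obtain ⟨y, hy, hyx⟩ := hx
  let A : Set ι := {u | u ≠ v ∧ direction β v (Sum.inr u) = β v x}
  -- A vertex separating two leaves of the fibre from each other must lie in the direction of that
  -- fibre.
  have hA : ∀ s y z, s ≠ y → β v s = β v x → β v y = β v x → β v z ≠ β v x →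
      ∃ u ∈ A, β u s ≠ β u y ∧ β u s ≠ β u z ∧ β u y ≠ β u z := by
    intro s y z hsy hs hy hz
    obtain ⟨t, rfl, rfl, rfl⟩ := exists_triple hsy (c := z) (fun e => hz (e ▸ hs)) (fun e => hz (e ▸ hy))
    obtain ⟨u, hu⟩ := h.separates t
    have h01 : β u (t 0) ≠ β u (t 1) := hu.ne (show (0 : Fin 3) ≠ 1 by decide)
    have huv : u ≠ v := by
      rintro rfl
      exact h01 (hs.trans hy.symm)
    refine ⟨u, ⟨huv, ?_⟩, h01, hu.ne (show (0 : Fin 3) ≠ 2 by decide),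
      hu.ne (show (1 : Fin 3) ≠ 2 by decide)⟩
    by_contra hne
    exact h01 ((h.eq_right huv.symm fun e => hne (e.symm.trans hs)).trans
      (h.eq_right huv.symm fun e => hne (e.symm.trans hy)).symm)
  obtain ⟨z, hz, -⟩ := h.exists_ne v (β v x) (β v x)
  obtain ⟨u₀, hu₀, -⟩ := hA y x z hyx hy rfl hz
  -- The neighbour is the vertex in this direction with the most leaves beyond it. If a leaf `s` lay
  -- between it and `v`, the vertex separating `s`, a leaf `y` beyond `u` and a leaf `z` behind `v`
  -- would have all these leaves and `s` beyond it.
  obtain ⟨u, ⟨huv, hu⟩, hmax⟩ := Set.exists_max_image A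
    (fun u => {k | β u k ≠ direction β u (Sum.inr v)}.ncard) (Set.toFinite _) ⟨u₀, hu₀⟩
  refine ⟨Sum.inr u, familyGraph_adj_inr.2 ⟨huv.symm, fun s hs => ?_⟩, hu⟩
  obtain ⟨hs1, hs2⟩ := hs
  obtain ⟨y, hy, -⟩ := h.exists_ne u (direction β u (Sum.inr v)) (direction β u (Sum.inr v))
  have hvy := (h.eq_right huv hy).trans hu
  have hsy : s ≠ y := by
    rintro rfl
    exact hy hs2
  have huz := h.eq_right huv.symm (fun e => hz (e.trans hu))
  obtain ⟨w, ⟨hwv, hw⟩, h1, h2, h3⟩ := hA s y z hsy (hs1.trans hu) hvy hz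
  have hwu : w ≠ u := by
    rintro rfl
    exact h2 (hs2.trans huz.symm)
  have hwz := h.eq_right hwv.symm (fun e => hz (e.trans hw))
  have hdir : direction β u (Sum.inr w) = direction β u (Sum.inr v) := by
    by_contra hne
    exact h2 ((h.eq_right hwu.symm fun e => hne (e.symm.trans hs2)).trans
      (h.eq_right hwu.symm fun e => hne (e.symm.trans huz)).symm)
  have hwy := h.eq_right hwu.symm (fun e => hy (e.trans hdir))
  refine absurd (hmax w ⟨hwv, hw⟩) (not_le.2 (Set.ncard_lt_ncard ⟨fun k hk => ?_, fun hsub => ?_⟩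
    (Set.toFinite _)))
  · change β w k ≠ _
    rw [h.eq_right hwu.symm (fun e => hk (e.trans hdir)), ← hwy, ← hwz]
    exact h3
  · exact hsub (show β w s ≠ _ by rw [← hwz]; exact h2) hs2

/-- The neighbour is the vertex with the smallest fibre around `x`. A second leaf in this fibre
could be split off by the vertex that separates it, `x` and a leaf outside, with a strictly smaller
fibre around `x`. -/
theorem exists_adj_leaf (h : TreeFamily β) (hX : 3 ≤ Nat.card X) (x : X) :
    ∃ v, (familyGraph β).Adj (Sum.inl x) (Sum.inr v) := by
  have hι : Nonempty ι := (nonempty_triple hX).map fun t => (h.separates t).choose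
  obtain ⟨v, -, hmin⟩ := Set.exists_min_image (Set.univ : Set ι)
    (fun u => {k | β u k = β u x}.ncard) (Set.toFinite _) Set.univ_nonempty
  refine ⟨v, fun y hy => ?_⟩
  by_contra hyx
  obtain ⟨z, hz, -⟩ := h.exists_ne v (β v x) (β v x)
  obtain ⟨t, rfl, rfl, rfl⟩ := exists_triple (Ne.symm hyx) (c := z) (fun e => hz (e ▸ rfl))
    (fun e => hz (e ▸ hy))
  obtain ⟨u, hu⟩ := h.separates t
  have h01 : β u (t 0) ≠ β u (t 1) := hu.ne (show (0 : Fin 3) ≠ 1 by decide)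
  have h02 : β u (t 0) ≠ β u (t 2) := hu.ne (show (0 : Fin 3) ≠ 2 by decide)
  have huv : u ≠ v := by
    rintro rfl
    exact h01 hy.symm
  have hdir : direction β v (Sum.inr u) = β v (t 0) := by
    by_contra hne
    exact h01 ((h.eq_right huv.symm fun e => hne e.symm).trans
      (h.eq_right huv.symm fun e => hne (e.symm.trans hy)).symm)
  have hz' := h.eq_right huv.symm (fun e => hz (e.trans hdir))
  refine absurd (hmin u trivial) (not_le.2 (Set.ncard_lt_ncard ⟨fun k hk => ?_, fun hsub => ?_⟩
    (Set.toFinite _)))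
  · have hk' : β u k = β u (t 0) := hk
    exact (h.eq_right huv (by rw [hk', ← hz']; exact h02)).trans hdir
  · exact h01 (hsub (show β v (t 1) = _ from hy)).symm

omit [Finite X] [Finite ι] in
theorem adj_leaf_unique (h : TreeFamily β) {x : X} {a b : X ⊕ ι}
    (ha : (familyGraph β).Adj (Sum.inl x) a) (hb : (familyGraph β).Adj (Sum.inl x) b) : a = b := by
  have key : ∀ u v : ι, u ≠ v → (∀ y, β u y = β u x → y = x) →
      β u x ≠ direction β u (Sum.inr v) := by
    intro u v huv hu he
    obtain ⟨y, hy1, hy2⟩ := h.exists_ne v (direction β v (Sum.inr u)) (β v x)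
    exact hy2 (congrArg _ (hu y ((h.eq_right huv.symm hy1).trans he.symm)))
  rcases a with _ | u
  · exact ha.elim
  rcases b with _ | v
  · exact hb.elim
  by_contra hne
  have huv : u ≠ v := fun e => hne (congrArg _ e)
  rcases h.direction_or huv x with e | e
  · exact key u v huv ha e
  · exact key v u huv.symm hb e

/-- Each step along the edge towards `r` strictly shrinks the fibre that contains `r`. -/
theorem reachable_leaf (h : TreeFamily β) (r : X) (v : ι) :
    (familyGraph β).Reachable (Sum.inr v) (Sum.inl r) := by
  induction hn : {x | β v x = β v r}.ncard using Nat.strong_induction_on generalizing v with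
  | _ n ih =>
  obtain ⟨w, hw, hdir⟩ := h.exists_adj v r
  rcases w with y | u
  · rw [hw r hdir.symm]
    exact hw.reachable
  · refine hw.reachable.trans (ih _ ?_ u rfl)
    rw [← hn]
    have hur : β u r ≠ direction β u (Sum.inr v) := fun e => hw.2 r ⟨hdir.symm, e⟩
    refine Set.ncard_lt_ncard ⟨fun k hk => ?_, fun hsub => ?_⟩ (Set.toFinite _)
    · have hk' : β u k = β u r := hk
      exact (h.eq_right hw.1.symm (hk'.trans_ne hur)).trans hdir
    · obtain ⟨k, hk1, hk2⟩ := h.exists_ne u (direction β u (Sum.inr v)) (β u r)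
      exact hk2 (hsub ((h.eq_right hw.1.symm hk1).trans hdir))

/-- Connectedness comes from walking to a fixed leaf. Paths are unique because the direction of the
end point, constant along a walk avoiding the starting vertex, determines the first edge. -/
theorem isTree (h : TreeFamily β) (hX : 3 ≤ Nat.card X) : (familyGraph β).IsTree := by
  have : Nonempty X := (Nat.card_pos_iff.1 (by omega)).1
  obtain ⟨r⟩ := this
  have hr : ∀ a, (familyGraph β).Reachable a (Sum.inl r) := by
    rintro (x | v)
    · obtain ⟨v, hv⟩ := h.exists_adj_leaf hX x
      exact hv.reachable.trans (h.reachable_leaf r v)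
    · exact h.reachable_leaf r v
  have : Nonempty (X ⊕ ι) := ⟨Sum.inl r⟩
  refine ⟨⟨fun a b => (hr a).trans (hr b).symm⟩, 
    SimpleGraph.isAcyclic_iff_subsingleton_path.2 fun a b => ⟨?_⟩⟩
  suffices hsuff : ∀ a b (p q : (familyGraph β).Walk a b), p.IsPath → q.IsPath → p = q from
    fun p q => Subtype.ext (hsuff a b p.1 q.1 p.2 q.2)
  clear a b
  intro a b p q hp hq
  induction p with
  | nil =>
    exact (SimpleGraph.Walk.eq_nil_iff_nil.2 (SimpleGraph.Walk.isPath_iff_nil.1 hq)).symm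
  | @cons a c b hac p ih =>
    cases q with
    | nil => exact absurd hp (by simp)
    | @cons _ d _ had q =>
      rw [SimpleGraph.Walk.cons_isPath_iff] at hp hq
      have hcd : c = d := by
        rcases a with x | v
        · exact h.adj_leaf_unique hac had
        · exact h.eq_of_direction_eq hac had
            ((h.direction_eq_of_walk p hp.2).trans (h.direction_eq_of_walk q hq.2).symm)
      subst hcd
      rw [ih q hp.1 hq.1]

theorem leaf_degree (h : TreeFamily β) (hX : 3 ≤ Nat.card X) (x : X) :
    ((familyGraph β).neighborSet (Sum.inl x)).encard = 1 := by
  obtain ⟨v, hv⟩ := h.exists_adj_leaf hX x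
  exact Set.encard_eq_one.2 ⟨Sum.inr v, Set.eq_singleton_iff_unique_mem.2
    ⟨hv, fun b hb => h.adj_leaf_unique hb hv⟩⟩

theorem internal_degree (h : TreeFamily β) (v : ι) :
    3 ≤ ((familyGraph β).neighborSet (Sum.inr v)).encard := by
  obtain ⟨s⟩ := ‹Nonempty S›
  obtain ⟨x, -, -⟩ := h.exists_ne v s s
  obtain ⟨y, hy, -⟩ := h.exists_ne v (β v x) (β v x)
  obtain ⟨z, hz, hz'⟩ := h.exists_ne v (β v x) (β v y)
  obtain ⟨a, ha, ha'⟩ := h.exists_adj v x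
  obtain ⟨b, hb, hb'⟩ := h.exists_adj v y
  obtain ⟨c, hc, hc'⟩ := h.exists_adj v z
  have hsub : {a, b, c} ⊆ (familyGraph β).neighborSet (Sum.inr v) := by
    rintro w (rfl | rfl | rfl) <;> assumption
  refine le_trans (le_of_eq ?_) (Set.encard_le_encard hsub)
  refine (Set.encard_eq_three.2 ⟨a, b, c, ?_, ?_, ?_, rfl⟩).symm
  · rintro rfl
    exact hy (hb'.symm.trans ha')
  · rintro rfl
    exact hz (hc'.symm.trans ha')
  · rintro rfl
    exact hz' (hc'.symm.trans hb')

end TreeFamily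

end TreeFamily

/-! ### The tree of spheres of a compatible family -/

namespace TreeOfSpheres

variable {X : Type u} (T : TreeOfSpheres X)

theorem normalized_tMarking (t : Fin 3 ↪ X) : Normalized (T.tMarking t) t :=
  have h := (T.sphere (T.vertex t)).chart_spec (fun k => T.marking (T.vertex t) (t k))
    (T.vertex_spec t).injective
  ⟨h.2.1, h.2.2.1, h.2.2.2⟩

/-- The isomorphism class of a tree of spheres. -/
def toModuli : ModuliTrees X := Quotient.mk _ T

theorem extend_crossRatioMap : extend (crossRatioMap X T.toModuli) = T.tMarking :=
  extend_eq T.normalized_tMarking fun _ => rfl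

theorem tChart_mem (t : Fin 3 ↪ X) : T.tChart t ∈ (T.sphere (T.vertex t)).charts :=
  ((T.sphere (T.vertex t)).chart_spec (fun k => T.marking (T.vertex t) (t k))
    (T.vertex_spec t).injective).1

variable {T}

theorem exists_chart_tMarking {t : Fin 3 ↪ X} {v : T.Internal} (hv : T.vertex t = v) :
    ∃ σ ∈ (T.sphere v).charts, ∀ x, T.tMarking t x = σ (T.marking v x) := by
  subst hv
  exact ⟨T.tChart t, T.tChart_mem t, fun _ => rfl⟩

theorem branch_eq_of_reachable {v : T.Internal} {x y : X}
    (h : (T.graph.deleteIncidenceSet (Sum.inr v)).Reachable (Sum.inl x) (Sum.inl y)) :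
    T.branch v x = T.branch v y :=
  T.eq_branch v y _ ((T.branch_spec v x).trans h)

theorem marking_eq_iff {v : T.Internal} {x y : X} :
    T.marking v x = T.marking v y ↔ T.branch v x = T.branch v y :=
  (T.attach_injective v).eq_iff

theorem separates_of_injective {v : T.Internal} {t : Fin 3 ↪ X}
    (h : Function.Injective fun k => T.marking v (t k)) : T.Separates v t :=
  fun _ _ hjk hr => hjk (h (marking_eq_iff.2 (branch_eq_of_reachable hr)))

theorem vertex_eq_of_injective {v : T.Internal} {t : Fin 3 ↪ X}
    (h : Function.Injective fun k => T.marking v (t k)) : T.vertex t = v :=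
  (T.vertex_spec t).unique (separates_of_injective h)

theorem tMarking_eq_iff {t : Fin 3 ↪ X} {x y : X} : T.tMarking t x = T.tMarking t y ↔
    T.marking (T.vertex t) x = T.marking (T.vertex t) y :=
  (T.tChart t).injective.eq_iff

/-- A vertex is the one of `s` exactly when its marking separates `s`, so the markings show which
triples share a vertex. -/
theorem vertex_eq_vertex_iff {t s : Fin 3 ↪ X} :
    T.vertex t = T.vertex s ↔ Function.Injective (T.tMarking t ∘ s) := by
  have e : Function.Injective (T.tMarking t ∘ s) ↔
      Function.Injective fun k => T.marking (T.vertex t) (s k) :=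
    (T.tChart t).injective.of_comp_iff _
  rw [e]
  refine ⟨fun h => ?_, fun h => (vertex_eq_of_injective h).symm⟩
  rw [h]
  exact (T.vertex_spec s).injective

end TreeOfSpheres

/-! ### Realization of a compatible family by a tree of spheres -/

section FamilyTree

variable {X : Type u} [Finite X] {ι : Type} [Finite ι] {β : ι → X → Sphere}

/-- The tree of spheres of a family of markings. -/
noncomputable def familyTree (h : TreeFamily β) (hX : 3 ≤ Nat.card X) : TreeOfSpheres X where
  Internal := ι
  finite_internal := inferInstance
  graph := familyGraph β
  isTree := h.isTree hX
  leaf_degree := h.leaf_degree hX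
  internal_degree := h.internal_degree
  sphere _ := ProjectiveSphere.standard
  attach v w := (direction β v (w : X ⊕ ι) : Sphere)
  attach_injective _ a b hab := Subtype.ext (h.eq_of_direction_eq a.2 b.2 hab)

theorem marking_familyTree (h : TreeFamily β) (hX : 3 ≤ Nat.card X) (v : ι) (x : X) :
    (familyTree h hX).marking v x = β v x := by
  obtain ⟨p, -, hp⟩ := exists_path_of_reachable
    ((familyGraph β).ne_of_adj ((familyTree h hX).branch v x).2).symm
    ((familyTree h hX).branch_spec v x)
  exact h.direction_eq_of_walk p hp

theorem exists_tMarking_familyTree (h : TreeFamily β) (hX : 3 ≤ Nat.card X) {t : Fin 3 ↪ X} {v : ι}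
    (hv : Function.Injective (β v ∘ t)) :
    ∃ g : GL (Fin 2) ℂ, ∀ x, (familyTree h hX).tMarking t x = g • β v x := by
  have hinj : Function.Injective fun k => (familyTree h hX).marking v (t k) := by
    intro j k hjk
    simp only [marking_familyTree] at hjk
    exact hv hjk
  obtain ⟨σ, ⟨g, rfl⟩, hσ⟩ :=
    TreeOfSpheres.exists_chart_tMarking (TreeOfSpheres.vertex_eq_of_injective hinj)
  refine ⟨g, fun x => ?_⟩
  rw [hσ, marking_familyTree]
  rfl

theorem compatibleFamilies_subset_range (hX : 3 ≤ Nat.card X) :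
    compatibleFamilies X ⊆ Set.range (crossRatioMap X) := by
  intro f hf
  let V := Quotient (markingSetoid f fun _ => True)
  have : Finite (Fin 3 ↪ X) := Finite.of_injective _ DFunLike.coe_injective
  have : Finite V := Quotient.finite _
  -- Internal vertices must form a type in `Type`, whereas the classes of triples live in the
  -- universe of `X`; hence the reindexing.
  let e : V ≃ Fin (Nat.card V) := Finite.equivFin V
  let β : Fin (Nat.card V) → X → Sphere := fun v => classMarking f (fun _ => True) (e.symm v)
  have hβ : ∀ t, ∃ (v : Fin (Nat.card V)) (g : GL (Fin 2) ℂ),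
      ∀ x, β v x = g • extend f t x := by
    intro t
    obtain ⟨g, hg⟩ := classMarking_mk f (fun _ => True) (t := t) trivial
    refine ⟨e (Quotient.mk _ ⟨t, trivial⟩), g, fun x => ?_⟩
    simp only [β, e.symm_apply_apply]
    exact hg x
  have hinj : ∀ {t : Fin 3 ↪ X} {v} {g : GL (Fin 2) ℂ}, (∀ x, β v x = g • extend f t x) →
      Function.Injective (β v ∘ t) := by
    intro t v g hg j k hjk
    simp only [Function.comp_apply, hg] at hjk
    exact (normalized_extend f t).injective (MulAction.injective g hjk)
  have h : TreeFamily β :=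
    { compat := fun u v huv => classMarking_compat hf _ (e.symm.injective.ne huv)
      exists_ne := fun v => classMarking_exists_ne f _ _
      separates := fun t => by
        obtain ⟨v, g, hg⟩ := hβ t
        exact ⟨v, hinj hg⟩ }
  refine ⟨(familyTree h hX).toModuli, ?_⟩
  funext q
  rw [← extend_quad f, ← extend_quad (crossRatioMap X _), TreeOfSpheres.extend_crossRatioMap]
  obtain ⟨v, g, hg⟩ := hβ q.triple
  obtain ⟨k, hk⟩ := exists_tMarking_familyTree h hX (hinj hg)
  rw [(normalized_extend f q.triple).eq_of_smul ((familyTree h hX).normalized_tMarking q.triple)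
    (g := k * g) fun x => by rw [hk, hg, mul_smul]]

end FamilyTree

/-! ### Markings determine a tree of spheres -/

/-- A vertex `y` is on the side of `v'` seen from `v`, or on the side of `v` seen from `v'`. -/
theorem reachable_or_reachable {V : Type*} {G : SimpleGraph V} (hG : G.Connected) {v v' : V}
    (hne : v ≠ v') (y : V) :
    (G.deleteIncidenceSet v).Reachable v' y ∨ (G.deleteIncidenceSet v').Reachable v y := by
  classical
  obtain ⟨p, hp⟩ := hG.exists_isPath v y
  by_cases hv' : v' ∈ p.support
  · left
    refine reachable_of_walk (p.dropUntil _ hv') fun hv => ?_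
    rw [← p.take_spec hv', SimpleGraph.Walk.isPath_def, SimpleGraph.Walk.support_append] at hp
    refine (List.nodup_append.1 hp).2.2 _ (SimpleGraph.Walk.start_mem_support _) _ ?_ rfl
    rw [SimpleGraph.Walk.mem_support_iff] at hv
    exact hv.resolve_left hne
  · exact Or.inr (reachable_of_walk p hv')

/-- Nothing lies behind a vertex whose only neighbour is removed. -/
theorem eq_of_reachable_of_forall_adj {V : Type*} {G : SimpleGraph V} {v a y : V}
    (ha : ∀ c, G.Adj a c → c = v) (h : (G.deleteIncidenceSet v).Reachable a y) : y = a := by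
  obtain ⟨p⟩ := h
  cases p with
  | nil => rfl
  | cons hac _ =>
    rw [SimpleGraph.deleteIncidenceSet_adj] at hac
    exact absurd (ha _ hac.1) hac.2.2

namespace TreeOfSpheres

variable {X : Type u} {T : TreeOfSpheres X}

theorem adj_leaf_unique {x : X} {a b : X ⊕ T.Internal} (ha : T.graph.Adj (Sum.inl x) a)
    (hb : T.graph.Adj (Sum.inl x) b) : a = b := by
  obtain ⟨w, hw⟩ := Set.encard_eq_one.1 (T.leaf_degree x)
  have h : ∀ c, T.graph.Adj (Sum.inl x) c → c = w := fun c hc => by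
    have : c ∈ T.graph.neighborSet (Sum.inl x) := hc
    rwa [hw] at this
  rw [h a ha, h b hb]

theorem exists_adj_ne (v : T.Internal) (a b : X ⊕ T.Internal) :
    ∃ c, T.graph.Adj (Sum.inr v) c ∧ c ≠ a ∧ c ≠ b := by
  by_contra! h
  have hsub : T.graph.neighborSet (Sum.inr v) ⊆ {a, b} := fun c hc =>
    or_iff_not_imp_left.2 (h c hc)
  have := (T.internal_degree v).trans ((Set.encard_le_encard hsub).trans
    (Set.encard_insert_le {b} a))
  rw [Set.encard_singleton] at this
  exact absurd this (by norm_num)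

/-- There is a leaf in each branch at an internal vertex. -/
theorem exists_branch_eq [Finite X] (v : T.Internal) (w : T.graph.neighborSet (Sum.inr v)) :
    ∃ x, T.branch v x = w := by
  have := T.finite_internal
  -- A vertex of the branch farthest from `v` is a leaf: an internal one would have a neighbour on
  -- the side away from `v`, farther still.
  obtain ⟨u, hu, hmax⟩ := Set.exists_max_image
    {u | (T.graph.deleteIncidenceSet (Sum.inr v)).Reachable (w : X ⊕ T.Internal) u}
    (fun u => T.graph.dist u (Sum.inr v)) (Set.toFinite _) ⟨w, SimpleGraph.Reachable.refl _⟩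
  rcases u with x | u
  · exact ⟨x, (T.eq_branch v x w hu).symm⟩
  exfalso
  have huv : (Sum.inr u : X ⊕ T.Internal) ≠ Sum.inr v := by
    intro e
    obtain ⟨p, -, hp⟩ := exists_path_of_reachable (T.graph.ne_of_adj w.2).symm hu
    cases Sum.inr_injective e
    exact hp p.end_mem_support
  obtain ⟨d, hd, hd'⟩ := existsUnique_branch T.isTree huv.symm
  obtain ⟨c, hc, hcd, -⟩ := exists_adj_ne u (d : X ⊕ T.Internal) d
  have hcv : ¬ (T.graph.deleteIncidenceSet (Sum.inr u)).Reachable c (Sum.inr v) := fun h =>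
    hcd (congrArg Subtype.val (hd' ⟨c, hc⟩ h))
  have hcv' : c ≠ Sum.inr v := by
    rintro rfl
    exact hcv (SimpleGraph.Reachable.refl _)
  have h1 := (reachable_or_reachable T.isTree.1 (T.graph.ne_of_adj hc) (Sum.inr v)).resolve_left hcv
  have h2 := dist_branch T.isTree hc.symm h1
  have h3 : (T.graph.deleteIncidenceSet (Sum.inr v)).Adj (Sum.inr u) c := by
    rw [SimpleGraph.deleteIncidenceSet_adj]
    exact ⟨hc, huv, hcv'⟩
  have h4 := hmax c (hu.trans h3.reachable)
  omega

/-- The branch at `v` towards another internal vertex. -/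
theorem exists_toward {v v' : T.Internal} (hne : v ≠ v') :
    ∃ w : T.graph.neighborSet (Sum.inr v),
      (T.graph.deleteIncidenceSet (Sum.inr v)).Reachable (w : X ⊕ T.Internal) (Sum.inr v') ∧
      ∀ w' : T.graph.neighborSet (Sum.inr v), (T.graph.deleteIncidenceSet (Sum.inr v)).Reachable
        (w' : X ⊕ T.Internal) (Sum.inr v') → w' = w :=
  existsUnique_branch T.isTree fun e => hne (Sum.inr_injective e).symm

theorem branch_eq_or {v v' : T.Internal} (hne : v ≠ v') {w : T.graph.neighborSet (Sum.inr v)}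
    {w' : T.graph.neighborSet (Sum.inr v')}
    (hw : (T.graph.deleteIncidenceSet (Sum.inr v)).Reachable (w : X ⊕ T.Internal) (Sum.inr v'))
    (hw' : (T.graph.deleteIncidenceSet (Sum.inr v')).Reachable (w' : X ⊕ T.Internal) (Sum.inr v))
    (x : X) : T.branch v x = w ∨ T.branch v' x = w' := by
  rcases reachable_or_reachable T.isTree.1 (fun e => hne (Sum.inr_injective e)) (Sum.inl x)
    with h | h
  · exact Or.inl (T.eq_branch v x w (hw.trans h)).symm
  · exact Or.inr (T.eq_branch v' x w' (hw'.trans h)).symm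

/-- Triples with the same vertex give two charts of one sphere. For different vertices the special
values are the attaching points of the edges facing each other. -/
theorem crossRatioMap_mem (T : TreeOfSpheres X) :
    crossRatioMap X T.toModuli ∈ compatibleFamilies X := by
  intro t t'
  rw [extend_crossRatioMap]
  by_cases hv : T.vertex t = T.vertex t'
  · left
    obtain ⟨σ, hσ, hσ'⟩ := exists_chart_tMarking hv
    obtain ⟨g, hg⟩ := ((T.sphere _).mem_charts_iff σ hσ _).1 (T.tChart_mem t')
    exact ⟨g, fun x => (hg _).trans (by rw [hσ'])⟩
  · right
    obtain ⟨w, hw, -⟩ := exists_toward hv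
    obtain ⟨w', hw', -⟩ := exists_toward (Ne.symm hv)
    refine ⟨T.tChart t (T.attach _ w), T.tChart t' (T.attach _ w'), fun x => ?_⟩
    refine (branch_eq_or hv hw hw' x).imp (fun h => ?_) fun h => ?_ <;>
      rw [← h] <;> rfl

theorem exists_vertex_eq [Finite X] (v : T.Internal) : ∃ t, T.vertex t = v := by
  obtain ⟨a, ha, -⟩ := exists_adj_ne v (Sum.inr v) (Sum.inr v)
  obtain ⟨b, hb, hba, -⟩ := exists_adj_ne v a a
  obtain ⟨c, hc, hca, hcb⟩ := exists_adj_ne v a b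
  obtain ⟨x, hx⟩ := exists_branch_eq v ⟨a, ha⟩
  obtain ⟨y, hy⟩ := exists_branch_eq v ⟨b, hb⟩
  obtain ⟨z, hz⟩ := exists_branch_eq v ⟨c, hc⟩
  have hxy : T.branch v x ≠ T.branch v y := by
    rw [hx, hy]; exact fun e => hba (congrArg Subtype.val e).symm
  have hxz : T.branch v x ≠ T.branch v z := by
    rw [hx, hz]; exact fun e => hca (congrArg Subtype.val e).symm
  have hyz : T.branch v y ≠ T.branch v z := by
    rw [hy, hz]; exact fun e => hcb (congrArg Subtype.val e).symm
  obtain ⟨t, rfl, rfl, rfl⟩ := exists_triple (ne_of_apply_ne _ hxy) (ne_of_apply_ne _ hxz)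
    (ne_of_apply_ne _ hyz)
  refine ⟨t, vertex_eq_of_injective (injective_of_three ?_ ?_ ?_)⟩ <;>
    rwa [ne_eq, marking_eq_iff]

theorem not_adj_leaf_leaf [Finite X] (hX : 3 ≤ Nat.card X) (x y : X) :
    ¬ T.graph.Adj (Sum.inl x) (Sum.inl y) := by
  intro h
  obtain ⟨z, hzx, hzy⟩ := exists_ne_and_ne hX x y
  obtain ⟨⟨w, hw⟩, hr, -⟩ := existsUnique_branch T.isTree (v := Sum.inl x) (x := Sum.inl z)
    (fun e => hzx (Sum.inl_injective e))
  obtain rfl := adj_leaf_unique h hw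
  exact hzy (Sum.inl_injective (eq_of_reachable_of_forall_adj
    (fun c hc => adj_leaf_unique hc h.symm) hr))

/-- The edges at the leaves are determined by the markings. -/
theorem adj_leaf_iff [Finite X] {v : T.Internal} {x : X} :
    T.graph.Adj (Sum.inr v) (Sum.inl x) ↔ ∀ y, T.marking v y = T.marking v x → y = x := by
  simp only [marking_eq_iff]
  constructor
  · intro h y hy
    have hx := T.eq_branch v x ⟨_, h⟩ (SimpleGraph.Reachable.refl _)
    have h1 := T.branch_spec v y
    rw [hy, ← hx] at h1
    exact Sum.inl_injective (eq_of_reachable_of_forall_adj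
      (fun c hc => adj_leaf_unique hc h.symm) h1)
  · intro h
    obtain ⟨⟨w, hw⟩, hwx⟩ : ∃ w, T.branch v x = w := ⟨_, rfl⟩
    rcases w with y | u
    · have hy := T.eq_branch v y ⟨_, hw⟩ (SimpleGraph.Reachable.refl _)
      rw [← h y (by rw [← hy, hwx])]
      exact hw
    · exfalso
      have hne : v ≠ u := fun e => T.graph.ne_of_adj hw (congrArg _ e)
      -- All leaves beyond `u` are in the fibre of `x` at `v`, so `x` would lie in two different
      -- branches at `u`.
      have key : ∀ c (hc : T.graph.Adj (Sum.inr u) c), c ≠ Sum.inr v →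
          T.branch u x = ⟨c, hc⟩ := by
        intro c hc hcv
        obtain ⟨k, hk⟩ := exists_branch_eq u ⟨c, hc⟩
        rcases branch_eq_or hne (w := ⟨_, hw⟩) (w' := ⟨_, hw.symm⟩) (SimpleGraph.Reachable.refl _)
          (SimpleGraph.Reachable.refl _) k with e | e
        · rw [← h k (e.trans hwx.symm), hk]
        · rw [hk] at e
          exact absurd (congrArg Subtype.val e) hcv
      obtain ⟨c, hc, hcv, -⟩ := exists_adj_ne u (Sum.inr v) (Sum.inr v)
      obtain ⟨d, hd, hdv, hdc⟩ := exists_adj_ne u (Sum.inr v) c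
      exact hdc (congrArg Subtype.val ((key d hd hdv).symm.trans (key c hc hcv)))

/-- The internal edges are determined by the markings. -/
theorem adj_internal_iff [Finite X] {v w : T.Internal} :
    T.graph.Adj (Sum.inr v) (Sum.inr w) ↔ v ≠ w ∧
      ∃ x y, ∀ z, T.marking v z = T.marking v x ↔ T.marking w z ≠ T.marking w y := by
  simp only [ne_eq, marking_eq_iff]
  constructor
  · intro h
    have hne : v ≠ w := fun e => T.graph.ne_of_adj h (congrArg _ e)
    obtain ⟨x, hx⟩ := exists_branch_eq v ⟨_, h⟩
    obtain ⟨y, hy⟩ := exists_branch_eq w ⟨_, h.symm⟩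
    refine ⟨hne, x, y, fun z => ?_⟩
    rw [hx, hy]
    refine ⟨fun h1 h2 => ?_, fun h1 => ?_⟩
    -- Such a leaf would be nearer to each end of the edge than to the other.
    · have r1 := T.branch_spec v z
      have r2 := T.branch_spec w z
      rw [h1] at r1
      rw [h2] at r2
      have d1 := dist_branch T.isTree h r1
      have d2 := dist_branch T.isTree h.symm r2
      omega
    · exact (branch_eq_or hne (w := ⟨_, h⟩) (w' := ⟨_, h.symm⟩) (SimpleGraph.Reachable.refl _)
        (SimpleGraph.Reachable.refl _) z).resolve_right h1
  · rintro ⟨hne, x, y, hxy⟩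
    by_contra hadj
    obtain ⟨a, ha, ha'⟩ := exists_toward hne
    obtain ⟨b, hb, hb'⟩ := exists_toward (Ne.symm hne)
    have hab := branch_eq_or hne ha hb
    -- the two complementary fibres are the ones that face each other
    have hxa : T.branch v x = a := by
      by_contra hxa
      -- Otherwise a leaf `k` in a third branch at `v` is, like `x`, seen by `w` in the direction of
      -- `v`. Being outside the fibre of `x`, it is in that of `y`, and then so is `x`.
      obtain ⟨c, hc, hcx, hca⟩ := exists_adj_ne v (T.branch v x : X ⊕ T.Internal) a
      obtain ⟨k, hk⟩ := exists_branch_eq v ⟨c, hc⟩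
      have h1 : T.branch w x = b := (hab x).resolve_left hxa
      have h2 : T.branch w k = b := (hab k).resolve_left
        fun e => hca (congrArg Subtype.val (hk.symm.trans e))
      have h3 : T.branch w k = T.branch w y := by
        by_contra h3
        exact hcx (congrArg Subtype.val (hk.symm.trans ((hxy k).2 h3)))
      exact (hxy x).1 rfl (h1.trans (h2.symm.trans h3))
    have hyb : T.branch w y = b := by
      by_contra hyb
      have h1 : T.branch v y = a := (hab y).resolve_right hyb
      exact (hxy y).1 (h1.trans hxa.symm) rfl
    obtain ⟨a, hva⟩ := a
    have haw : a ≠ Sum.inr w := by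
      rintro rfl
      exact hadj hva
    rcases a with l | u
    · exact haw (eq_of_reachable_of_forall_adj (fun c hc => adj_leaf_unique hc hva.symm) ha).symm
    · have hvu : v ≠ u := fun e => T.graph.ne_of_adj hva (congrArg _ e)
      have hwu : w ≠ u := fun e => haw (congrArg _ e.symm)
      -- The vertex `u` lies strictly between `v` and `w`. A leaf in a third branch at `u` is in
      -- both facing fibres, which therefore are not complementary.
      obtain ⟨d, hd, hd'⟩ := exists_toward hwu.symm
      obtain ⟨d', hd₁, -⟩ := exists_toward hwu
      obtain ⟨c, hc, hcv, hcd⟩ := exists_adj_ne u (Sum.inr v) (d : X ⊕ T.Internal)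
      obtain ⟨k, hk⟩ := exists_branch_eq u ⟨c, hc⟩
      have h1 : T.branch v k = ⟨_, hva⟩ :=
        (branch_eq_or hvu (w := ⟨_, hva⟩) (w' := ⟨_, hva.symm⟩) (SimpleGraph.Reachable.refl _)
          (SimpleGraph.Reachable.refl _) k).resolve_right
          fun e => hcv (congrArg Subtype.val (hk.symm.trans e))
      have h2 : T.branch w k = d' := (branch_eq_or hwu hd₁ hd k).resolve_right
          fun e => hcd (congrArg Subtype.val (hk.symm.trans e))
      have h3 : d' = b := by
        refine hb' _ (hd₁.trans ?_)
        refine SimpleGraph.Adj.reachable ?_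
        rw [SimpleGraph.deleteIncidenceSet_adj]
        exact ⟨hva.symm, haw, fun e => hne (Sum.inr_injective e)⟩
      exact (hxy k).1 (h1.trans hxa.symm) (h2.trans (h3.trans hyb.symm))

/-- Trees of spheres with the same markings are isomorphic. -/
theorem isomorphic_of_tMarking_eq [Finite X] (hX : 3 ≤ Nat.card X) {T T' : TreeOfSpheres X}
    (h : T.tMarking = T'.tMarking) : Isomorphic T T' := by
  have hvert : ∀ t s, T.vertex t = T.vertex s ↔ T'.vertex t = T'.vertex s := fun t s => by
    rw [vertex_eq_vertex_iff, vertex_eq_vertex_iff, h]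
  -- In both trees the internal vertices are the classes of triples under the same relation, which
  -- gives the bijection.
  choose τ hτ using fun v => exists_vertex_eq (T := T) v
  choose τ' hτ' using fun v => exists_vertex_eq (T := T') v
  let e : T.Internal ≃ T'.Internal :=
    { toFun := fun v => T'.vertex (τ v)
      invFun := fun v => T.vertex (τ' v)
      left_inv := fun v => by
        conv_rhs => rw [← hτ v]
        rw [hvert, hτ']
      right_inv := fun v => by
        conv_rhs => rw [← hτ' v]
        rw [← hvert, hτ] }
  have he : ∀ t, e (T.vertex t) = T'.vertex t := fun t => (hvert _ _).1 (hτ _)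
  have hmark : ∀ v x y, T'.marking (e v) x = T'.marking (e v) y ↔
      T.marking v x = T.marking v y := by
    intro v x y
    obtain ⟨t, rfl⟩ := exists_vertex_eq v
    rw [he, ← tMarking_eq_iff, ← tMarking_eq_iff, h]
  let E : X ⊕ T.Internal ≃ X ⊕ T'.Internal := Equiv.sumCongr (Equiv.refl X) e
  have hadj : ∀ a b, T'.graph.Adj (E a) (E b) ↔ T.graph.Adj a b := by
    have hleaf : ∀ v x, T'.graph.Adj (Sum.inr (e v)) (Sum.inl x) ↔
        T.graph.Adj (Sum.inr v) (Sum.inl x) := by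
      intro v x
      simp only [adj_leaf_iff, hmark]
    rintro (x | v) (y | w)
    · exact iff_of_false (not_adj_leaf_leaf hX _ _) (not_adj_leaf_leaf hX _ _)
    · exact (T'.graph.adj_comm _ _).trans ((hleaf w x).trans (T.graph.adj_comm _ _))
    · exact hleaf v y
    · change T'.graph.Adj (Sum.inr (e v)) (Sum.inr (e w)) ↔ _
      simp only [adj_internal_iff, ne_eq, hmark, e.injective.eq_iff]
  have hdel : ∀ v a b, (T'.graph.deleteIncidenceSet (Sum.inr (e v))).Adj (E a) (E b) ↔
      (T.graph.deleteIncidenceSet (Sum.inr v)).Adj a b := by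
    intro v a b
    have hv : (Sum.inr (e v) : X ⊕ T'.Internal) = E (Sum.inr v) := rfl
    rw [SimpleGraph.deleteIncidenceSet_adj, SimpleGraph.deleteIncidenceSet_adj, hv, hadj,
      E.injective.ne_iff, E.injective.ne_iff]
  have hreach : ∀ v a b, (T'.graph.deleteIncidenceSet (Sum.inr (e v))).Reachable (E a) (E b) ↔
      (T.graph.deleteIncidenceSet (Sum.inr v)).Reachable a b := fun v a b =>
    (show T.graph.deleteIncidenceSet (Sum.inr v) ≃g
      T'.graph.deleteIncidenceSet (Sum.inr (e v)) from ⟨E, hdel v _ _⟩).reachable_iff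
  refine ⟨e, hadj, fun v => ?_⟩
  obtain ⟨t, rfl⟩ := exists_vertex_eq v
  have hreach' := hreach (T.vertex t)
  rw [he] at hreach' ⊢
  -- The `t`-charts of both spheres are glued; equal `t`-markings mean that attaching points match,
  -- since every branch contains a leaf.
  refine ⟨(T.tChart t).trans (T'.tChart t).symm, fun σ hσ => ?_, fun w w' hw => ?_⟩
  · obtain ⟨g, hg⟩ := ((T'.sphere _).mem_charts_iff _ (T'.tChart_mem t) σ).1 hσ
    refine ((T.sphere _).mem_charts_iff _ (T.tChart_mem t) _).2 ⟨g, fun p => ?_⟩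
    simp [hg]
  · obtain ⟨x, rfl⟩ := exists_branch_eq _ w
    have hw' : w' = T'.branch (T'.vertex t) x := by
      refine T'.eq_branch _ x w' ?_
      rw [← hw]
      exact (hreach' _ (Sum.inl x)).2 (T.branch_spec _ x)
    rw [hw', Homeomorph.trans_apply, Homeomorph.symm_apply_eq]
    exact congrFun (congrFun h t) x

end TreeOfSpheres

/-! ### The image of the cross-ratio map and of the marked spheres -/

theorem crossRatioMap_injective (X : Type u) [Finite X] (hX : 3 ≤ Nat.card X) :
    Function.Injective (crossRatioMap X) := by
  intro c c'
  induction c using Quotient.inductionOn with | _ T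
  induction c' using Quotient.inductionOn with | _ T'
  intro h
  refine Quotient.sound (TreeOfSpheres.isomorphic_of_tMarking_eq hX ?_)
  rw [← T.extend_crossRatioMap, ← T'.extend_crossRatioMap]
  exact congrArg extend h

theorem range_crossRatioMap (X : Type u) [Finite X] (hX : 3 ≤ Nat.card X) :
    Set.range (crossRatioMap X) = compatibleFamilies X := by
  refine Set.Subset.antisymm ?_ (compatibleFamilies_subset_range hX)
  rintro _ ⟨c, rfl⟩
  induction c using Quotient.inductionOn with | _ T
  exact T.crossRatioMap_mem

theorem closure_range_markedSphereCrossRatios (X : Type u) [Finite X] [Nonempty X] :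
    closure (Set.range (markedSphereCrossRatios (X := X))) = compatibleFamilies X :=
  Set.Subset.antisymm
    (closure_minimal (range_markedSphereCrossRatios_subset X) (isClosed_compatibleFamilies X))
    compatibleFamilies_subset_closure

/-- A single internal vertex separates all triples, so its marking is injective and a chart makes it
an injection into the sphere. Conversely, a tree that realizes the cross-ratios of an injection has
injective markings; each then separates every triple, and all vertices coincide. -/
theorem image_smoothLocus (X : Type u) [Finite X] (hX : 3 ≤ Nat.card X) :
    crossRatioMap X '' smoothLocus X = Set.range (markedSphereCrossRatios (X := X)) := by
  apply Set.Subset.antisymm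
  · rintro _ ⟨_, ⟨T, hT, rfl⟩, rfl⟩
    have hsub : Subsingleton T.Internal := (Nat.card_eq_one_iff_unique.1 hT).1
    obtain ⟨v⟩ := (Nat.card_eq_one_iff_unique.1 hT).2
    obtain ⟨σ, hσ⟩ := (T.sphere v).charts_nonempty
    have hinj : Function.Injective (T.marking v) := by
      intro x y hxy
      by_contra hne
      obtain ⟨z, hzx, hzy⟩ := exists_ne_and_ne hX x y
      obtain ⟨t, rfl, rfl, rfl⟩ := exists_triple hne hzx.symm hzy.symm
      have := (T.vertex_spec t).injective
      rw [Subsingleton.elim (T.vertex t) v] at this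
      exact absurd (this hxy) (by decide)
    let i : X ↪ Sphere := ⟨fun x => σ (T.marking v x), σ.injective.comp hinj⟩
    refine ⟨i, ?_⟩
    funext q
    rw [← extend_quad (markedSphereCrossRatios i)]
    refine Eq.trans ?_ (extend_quad (crossRatioMap X T.toModuli) q)
    rw [T.extend_crossRatioMap]
    obtain ⟨g, hg⟩ := exists_extend_markedSphereCrossRatios i q.triple
    obtain ⟨τ, hτ, hτ'⟩ :=
      TreeOfSpheres.exists_chart_tMarking (Subsingleton.elim (T.vertex q.triple) v)
    obtain ⟨k, hk⟩ := ((T.sphere v).mem_charts_iff σ hσ τ).1 hτ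
    rw [(T.normalized_tMarking q.triple).eq_of_smul (normalized_extend _ q.triple) (g := g * k⁻¹)
      fun x => ?_]
    rw [hg, hτ', hk, mul_smul, inv_smul_smul]
    rfl
  · rintro _ ⟨i, rfl⟩
    obtain ⟨c, hc⟩ := compatibleFamilies_subset_range hX
      (range_markedSphereCrossRatios_subset X ⟨i, rfl⟩)
    refine ⟨c, ?_, hc⟩
    induction c using Quotient.inductionOn with | _ T
    refine ⟨T, Nat.card_eq_one_iff_unique.2 ⟨⟨fun v w => ?_⟩, ?_⟩, rfl⟩
    · obtain ⟨t, rfl⟩ := TreeOfSpheres.exists_vertex_eq v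
      obtain ⟨s, rfl⟩ := TreeOfSpheres.exists_vertex_eq w
      have hc' : crossRatioMap X T.toModuli = markedSphereCrossRatios i := hc
      obtain ⟨g, hg⟩ := exists_extend_markedSphereCrossRatios i t
      rw [TreeOfSpheres.vertex_eq_vertex_iff, ← T.extend_crossRatioMap, hc']
      intro j k hjk
      simp only [Function.comp_apply, hg] at hjk
      exact s.injective (i.injective (MulAction.injective g hjk))
    · exact (nonempty_triple hX).map T.vertex

end TreesOfSpheres

theorem theorem2 (X : Type u) [Finite X] (hX : 3 ≤ Nat.card X) :
    IsEmbedding (TreesOfSpheres.crossRatioMap X) ∧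
    TreesOfSpheres.crossRatioMap X '' TreesOfSpheres.smoothLocus X =
      Set.range (TreesOfSpheres.markedSphereCrossRatios (X := X)) ∧
    Set.range (TreesOfSpheres.crossRatioMap X) =
      closure (TreesOfSpheres.crossRatioMap X '' TreesOfSpheres.smoothLocus X) ∧
    CompactSpace (TreesOfSpheres.ModuliTrees X) ∧
    Dense (TreesOfSpheres.smoothLocus X) := by
  have : Nonempty X := (Nat.card_pos_iff.1 (by omega)).1
  have hemb : IsEmbedding (TreesOfSpheres.crossRatioMap X) :=
    ⟨⟨rfl⟩, TreesOfSpheres.crossRatioMap_injective X hX⟩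
  have himg := TreesOfSpheres.image_smoothLocus X hX
  have hrange : Set.range (TreesOfSpheres.crossRatioMap X) =
      closure (TreesOfSpheres.crossRatioMap X '' TreesOfSpheres.smoothLocus X) := by
    rw [himg, TreesOfSpheres.range_crossRatioMap X hX,
      TreesOfSpheres.closure_range_markedSphereCrossRatios]
  refine ⟨hemb, himg, hrange, ⟨?_⟩, fun c => ?_⟩
  · rw [hemb.isInducing.isCompact_iff, Set.image_univ, hrange]
    exact isClosed_closure.isCompact
  · rw [hemb.isInducing.closure_eq_preimage_closure_image, ← hrange]
    exact ⟨c, rfl⟩
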